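/- Let $(\mathbb X,\mathcal X)$ be a standard Borel space, $\theta>0$, $\nu$ a probability measure on $\mathbb X$, and $R$ a transition kernel on $\mathbb X$ with $R_x(\mathbb X)<\infty$ for every $x$. A sequence $(X_n)_{n\ge1}$ of $\mathbb X$-valued random variables is a measure-valued Pólya sequence, MVPS$(\theta,\nu,R)$, if $X_1\sim\nu$ and, for every $n\ge1$, \[ \mathbb P(X_{n+1}\in\cdot\mid X_1,\dots,X_n)=\frac{\theta\nu(\cdot)+\sum_{i=1}^nR_{X_i}(\cdot)}{\theta+\sum_{i=1}^nR_{X_i}(\mathbb X)}\quad\text{a.s.} \] It is exchangeable if $(X_1,\dots,X_n)$ and $(X_{\sigma(1)},\dots,X_{\sigma(n)})$ have the same law for every $n$ and every permutation $\sigma$ of $\{1,\dots,n\}$. Let $Z=\{x\in\mathbb X:R_x(\mathbb X)=0\}$. A sub-$\sigma$-algebra $\mathcal G\subseteq\mathcal X$ is countably generated under $\nu$ if there is $C\in\mathcal G$ with $\nu(C)=1$ such that the trace $\sigma$-algebra $\mathcal G\cap C$ on $C$ is countably generated; $\nu(\cdot\mid\mathcal G)$ denotes a regular conditional distribution for $\nu$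 given $\mathcal G$. Let $(X_n)_{n\ge1}$ be an MVPS$(\theta,\nu,R)$. (a) If $(X_n)_{n\ge1}$ is exchangeable and $0<\nu(Z)<1$, then there exists a sub-$\sigma$-algebra $\mathcal G\subseteq\mathcal X$, countably generated under $\nu$, such that $Z^c\in\mathcal G$ and, as measures, \[ \frac{R_x(\cdot)}{R_x(\mathbb X)}=\nu(Z^c)\,\nu(\cdot\mid\mathcal G)(x)+\nu(Z)\,\nu(\cdot\mid Z)\qquad\text{for }\nu\text{-a.e. }x\in Z^c.\tag{$*$} \] (b) Conversely, if there is $m>0$ with $R_x(\mathbb X)=m$ for $\nu$-a.e. $x\in Z^c$, and $(*)$ holds for some sub-$\sigma$-algebra $\mathcal G\subseteq\mathcal X$ (not necessarily countably generated under $\nu$) with $Z^c\in\mathcal G$, then $(X_n)_{n\ge1}$ is exchangeable. (If $\nu(Z)=0$, the last term of $(*)$ is read as $0$.) -/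

import Mathlib

open MeasureTheory ProbabilityTheory
open scoped ENNReal

/-- The set `Z = {x : R_x(𝕏) = 0}` of null points of a kernel `R`. -/
def nullPart {𝕏 : Type*} {m𝕏 : MeasurableSpace 𝕏} (R : Kernel 𝕏 𝕏) : Set 𝕏 :=
  {x | R x Set.univ = 0}

/-- The σ-algebra generated by the first `n` variables `X 0, …, X (n - 1)` of a sequence. -/
abbrev pastSigma {Ω 𝕏 : Type*} [MeasurableSpace 𝕏] (X : ℕ → Ω → 𝕏) (n : ℕ) : MeasurableSpace Ω :=
  MeasurableSpace.comap (fun ω (i : Fin n) => X i ω) MeasurableSpace.pi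

/-- The sequence `X 0, X 1, …` (the first observation has index `0`) is a measure-valued Pólya
sequence with parameters `θ > 0`, `ν` (a probability measure) and `R` (a transition kernel with
`R_x(𝕏) < ∞` for every `x`): `X 0` has law `ν` and, for every `n ≥ 1`, the conditional law of `X n`
given `X 0, …, X (n - 1)` is `(θ ν + ∑_{i < n} R_{X i}) / (θ + ∑_{i < n} R_{X i}(𝕏))`. -/
structure IsMVPS {Ω 𝕏 : Type*} [MeasurableSpace Ω] [MeasurableSpace 𝕏] (P : Measure Ω)
    (X : ℕ → Ω → 𝕏) (θ : ℝ) (ν : Measure 𝕏) (R : Kernel 𝕏 𝕏) : Prop where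
  theta_pos : 0 < θ
  prob : ν Set.univ = 1
  finite_kernel : ∀ x, R x Set.univ < ∞
  measurable : ∀ n, Measurable (X n)
  law_zero : P.map (X 0) = ν
  predictive : ∀ n : ℕ, 1 ≤ n → ∀ A : Set 𝕏, MeasurableSet A →
    P⟦X n ⁻¹' A | pastSigma X n⟧ =ᵐ[P] fun ω =>
      (θ * ν.real A + ∑ i ∈ Finset.range n, (R (X i ω)).real A) /
        (θ + ∑ i ∈ Finset.range n, (R (X i ω)).real Set.univ)

/-- Infinite exchangeability: for all `n` and all permutations `σ` of the first `n` indices,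
`(X 0, …, X (n - 1))` and `(X (σ 0), …, X (σ (n - 1)))` have the same law. -/
def IsExchangeable {Ω 𝕏 : Type*} [MeasurableSpace Ω] [MeasurableSpace 𝕏] (P : Measure Ω)
    (X : ℕ → Ω → 𝕏) : Prop :=
  ∀ (n : ℕ) (σ : Equiv.Perm (Fin n)),
    P.map (fun ω (i : Fin n) => X (σ i) ω) = P.map (fun ω (i : Fin n) => X i ω)

/-- `R` is balanced on `Zᶜ`: there is `m > 0` with `R_x(𝕏) = m` for `ν`-a.e. `x ∈ Zᶜ`. -/
def BalancedOffNull {𝕏 : Type*} [MeasurableSpace 𝕏] (ν : Measure 𝕏) (R : Kernel 𝕏 𝕏) : Prop :=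
  ∃ m : ℝ, 0 < m ∧ ∀ᵐ x ∂ν, x ∈ (nullPart R)ᶜ → (R x).real Set.univ = m

/-- `G` is countably generated under `ν`: there is `C ∈ G` with `ν C = 1` such that the trace
σ-algebra of `G` on `C` is countably generated. -/
def CGUnder {𝕏 : Type*} (G : MeasurableSpace 𝕏) {m𝕏 : MeasurableSpace 𝕏} (ν : Measure 𝕏) : Prop :=
  ∃ C : Set 𝕏, MeasurableSet[G] C ∧ ν C = 1 ∧
    @MeasurableSpace.CountablyGenerated C (MeasurableSpace.comap Subtype.val G)

/-- `R_x / R_x(𝕏) = ν(Zᶜ) ν(· | G)(x) + ν(Z) ν(· | Z)` as measures, for `ν`-a.e. `x ∈ Zᶜ`.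
Here `condExpKernel ν G` is the regular conditional distribution `ν(· | G)` and
`ν[|Z]` is `ν(· | Z)`. -/
def HasMixtureForm {𝕏 : Type*} (G : MeasurableSpace 𝕏) {m𝕏 : MeasurableSpace 𝕏}
    [StandardBorelSpace 𝕏] (ν : Measure 𝕏) [IsFiniteMeasure ν] (R : Kernel 𝕏 𝕏) : Prop :=
  ∀ᵐ x ∂ν, x ∈ (nullPart R)ᶜ →
    (R x Set.univ)⁻¹ • R x =
      ν (nullPart R)ᶜ • condExpKernel ν G x + ν (nullPart R) • ν[|nullPart R]

/-! Write Z for `nullPart R`, ℓ(x) = θ + R_x(𝕏) for `urnMass`, K for the one-step transition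
operator `stepOp`, and D f = K f − ∫ f dν for `stepDev`.

Part (a) uses exchangeability of at most three observations. For two, it says that K is self-adjoint
in L²(ν). Since D vanishes identically on Z, a test function f supported on Z satisfies ∫ (D f)² dν
= ∫ f · D(D f) dν = 0. Hence the mass that R_x puts on Z is R_x(𝕏) ν(· ∩ Z), which is the last term
of the mixture. For three observations, clearing the denominator ℓ(X₀) + ℓ(X₁) − θ of the predictive
law gives `pair_identity`, an identity about two observations only.

The identity has two uses. If ℓ is not a.e. constant off Z, test it on light colours with D f ≥ 0
against heavy ones with D f ≤ 0. The bound K(x, ·) ≥ (θ/ℓ(x)) ν then forces D f = 0 there, and a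
sign analysis with ∫ D f dν = 0 gives D f = 0 a.e. for every f: R_x is proportional to ν. If ℓ = θ +
m a.e. off Z, the identity says that T f(x) = R_x(f) / (m ν(Zᶜ)), on functions living on Zᶜ, is a
self-adjoint idempotent which preserves the integral. The integral over x of the variance of T f
under the normalized reinforcement is therefore zero, so T f is R_x-a.s. constant on Zᶜ
(`balanced_invariant`).

Either way the normalized restriction κ of R to Zᶜ, completed by ν(· | Z) on Z, preserves ν, and for
each B the value κ_y(B) is constant for κ_x-a.e. y. Such a kernel is the conditional distribution of
ν given the σ-algebra generated by x ↦ κ_x (`exists_condExpKernel_eq`).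

For part (b), adjacent transpositions generate the permutations, and predictive laws depend on the
past only through a symmetric sum. It remains to swap the last two observations, that is, to show
that `twoStep` is symmetric in A and B. Under the mixture form it equals a symmetric expression plus
a multiple of ∫ κ_x(B) over A ∩ Zᶜ against the urn. That integral is symmetric because κ is a
conditional expectation (`twoStep_eq`, `setLIntegral_urnMeasure_symm`). -/

lemma measurableSet_nullPart {𝕏 : Type*} {m𝕏 : MeasurableSpace 𝕏} {R : Kernel 𝕏 𝕏} :
    MeasurableSet (nullPart R) :=
  R.measurable_coe MeasurableSet.univ (measurableSet_singleton 0)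

/-! ### Predictive laws as kernels -/

section Pred

variable {Ω 𝕏 : Type*} [mΩ : MeasurableSpace Ω] [m𝕏 : MeasurableSpace 𝕏]

/-- The measure `θ ν + ∑_{i < n} R_{x i}`, as a function of `x`. -/
noncomputable def urnMeasure (θ : ℝ) (ν : Measure 𝕏) (R : Kernel 𝕏 𝕏) {n : ℕ} (x : Fin n → 𝕏) :
    Measure 𝕏 :=
  ENNReal.ofReal θ • ν + ∑ i, R (x i)

lemma urnMeasure_apply (θ : ℝ) (ν : Measure 𝕏) (R : Kernel 𝕏 𝕏) {n : ℕ} (x : Fin n → 𝕏)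
    (A : Set 𝕏) :
    urnMeasure θ ν R x A = ENNReal.ofReal θ * ν A + ∑ i, R (x i) A := by
  simp [urnMeasure]

lemma measurable_urnMeasure_apply (θ : ℝ) (ν : Measure 𝕏) (R : Kernel 𝕏 𝕏) {n : ℕ}
    {A : Set 𝕏} (hA : MeasurableSet A) :
    Measurable fun x : Fin n → 𝕏 => urnMeasure θ ν R x A := by
  simp only [urnMeasure_apply]
  refine measurable_const.add (Finset.measurable_sum _ fun i _ => ?_)
  exact (R.measurable_coe hA).comp (measurable_pi_apply i)

/-- The predictive kernel of a measure-valued Pólya sequence given the first `n` observations. -/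
noncomputable def urnKernel (θ : ℝ) (ν : Measure 𝕏) (R : Kernel 𝕏 𝕏) (n : ℕ) :
    Kernel (Fin n → 𝕏) 𝕏 where
  toFun x := (urnMeasure θ ν R x Set.univ)⁻¹ • urnMeasure θ ν R x
  measurable' := by
    refine Measure.measurable_of_measurable_coe _ fun A hA => ?_
    simp only [Measure.smul_apply, smul_eq_mul]
    exact (measurable_urnMeasure_apply θ ν R MeasurableSet.univ).inv.mul
      (measurable_urnMeasure_apply θ ν R hA)

lemma urnKernel_apply (θ : ℝ) (ν : Measure 𝕏) (R : Kernel 𝕏 𝕏) (n : ℕ) (x : Fin n → 𝕏) :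
    urnKernel θ ν R n x = (urnMeasure θ ν R x Set.univ)⁻¹ • urnMeasure θ ν R x := rfl

/-- The first `n` observations. -/
def past (X : ℕ → Ω → 𝕏) (n : ℕ) (ω : Ω) (i : Fin n) : 𝕏 := X i ω

namespace IsMVPS

variable {P : Measure Ω} {X : ℕ → Ω → 𝕏} {θ : ℝ} {ν : Measure 𝕏} {R : Kernel 𝕏 𝕏}

lemma measurable_past (hX : IsMVPS P X θ ν R) (n : ℕ) : Measurable (past X n) :=
  measurable_pi_lambda _ fun i => hX.measurable i

lemma isProbabilityMeasure (hX : IsMVPS P X θ ν R) : IsProbabilityMeasure ν := ⟨hX.prob⟩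

lemma urnMeasure_univ_ne_zero (hX : IsMVPS P X θ ν R) {n : ℕ} (x : Fin n → 𝕏) :
    urnMeasure θ ν R x Set.univ ≠ 0 := by
  rw [urnMeasure_apply, hX.prob]
  simp [hX.theta_pos]

lemma urnMeasure_univ_ne_top (hX : IsMVPS P X θ ν R) {n : ℕ} (x : Fin n → 𝕏) :
    urnMeasure θ ν R x Set.univ ≠ ∞ := by
  rw [urnMeasure_apply, hX.prob]
  simpa using fun i => (hX.finite_kernel (x i)).ne

lemma isMarkovKernel (hX : IsMVPS P X θ ν R) (n : ℕ) : IsMarkovKernel (urnKernel θ ν R n) := by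
  refine ⟨fun x => ⟨?_⟩⟩
  rw [urnKernel_apply, Measure.smul_apply, smul_eq_mul]
  exact ENNReal.inv_mul_cancel (hX.urnMeasure_univ_ne_zero x) (hX.urnMeasure_univ_ne_top x)

lemma urnMeasure_real (hX : IsMVPS P X θ ν R) {n : ℕ} (x : Fin n → 𝕏) (A : Set 𝕏) :
    (urnMeasure θ ν R x).real A = θ * ν.real A + ∑ i, (R (x i)).real A := by
  have := hX.isProbabilityMeasure
  have hfin : ∀ i, R (x i) A ≠ ∞ := fun i =>
    ((measure_mono (Set.subset_univ A)).trans_lt (hX.finite_kernel (x i))).ne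
  rw [measureReal_def, urnMeasure_apply, ENNReal.toReal_add (by finiteness)
    (by simpa using hfin), ENNReal.toReal_mul, ENNReal.toReal_ofReal hX.theta_pos.le,
    ENNReal.toReal_sum fun i _ => hfin i]
  rfl

lemma urnKernel_real (hX : IsMVPS P X θ ν R) {n : ℕ} (x : Fin n → 𝕏) (A : Set 𝕏) :
    (urnKernel θ ν R n x).real A = (θ * ν.real A + ∑ i, (R (x i)).real A) /
      (θ + ∑ i, (R (x i)).real Set.univ) := by
  have := hX.isProbabilityMeasure
  have h := hX.urnMeasure_real x Set.univ
  rw [probReal_univ (μ := ν), mul_one] at h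
  rw [urnKernel_apply, measureReal_def, Measure.smul_apply, smul_eq_mul, ENNReal.toReal_mul,
    ENNReal.toReal_inv, ← measureReal_def, ← measureReal_def, h, hX.urnMeasure_real x A,
    div_eq_inv_mul]

/-- The predictive identities, each stated for one set A up to a null event, combine into a
disintegration of the joint law. All later computations of expectations start here. -/
lemma map_past_prod [IsProbabilityMeasure P] (hX : IsMVPS P X θ ν R) (n : ℕ) :
    P.map (fun ω => (past X n ω, X n ω)) = P.map (past X n) ⊗ₘ urnKernel θ ν R n := by
  have := hX.isProbabilityMeasure
  have := hX.isMarkovKernel n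
  have hp := hX.measurable_past n
  have hXn := hX.measurable n
  refine Measure.ext_prod fun {S A} hS hA => ?_
  rw [Measure.compProd_apply_prod hS hA, Measure.map_apply (hp.prodMk hXn) (hS.prod hA),
    setLIntegral_map hS ((urnKernel θ ν R n).measurable_coe hA) hp]
  rcases Nat.eq_zero_or_pos n with rfl | hn
  -- The defining property starts at n = 1. With an empty past, the space `Fin 0 → 𝕏` is a point and
  -- the urn kernel is θν/θ = ν, the law of the first observation.
  · have hS' : S = ∅ ∨ S = Set.univ := by
      rcases S.eq_empty_or_nonempty with h | ⟨x, hx⟩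
      · exact Or.inl h
      · exact Or.inr (Set.eq_univ_of_forall fun y => Subsingleton.elim x y ▸ hx)
    rcases hS' with rfl | rfl
    · simp
    have hk : ∀ x, urnKernel θ ν R 0 x A = ν A := fun x => by
      have h0 : ENNReal.ofReal θ ≠ 0 := by simp [hX.theta_pos]
      simp [urnKernel_apply, urnMeasure, ← mul_assoc, ENNReal.inv_mul_cancel h0]
    simp only [hk]
    simp [← hX.law_zero, Measure.map_apply hXn hA, Set.mk_preimage_prod]
  · have hle : pastSigma X n ≤ mΩ := by
      rw [pastSigma, MeasurableSpace.comap_le_iff_le_map]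
      exact hp
    have hT : MeasurableSet[pastSigma X n] (past X n ⁻¹' S) := ⟨S, hS, rfl⟩
    have hpre := hX.predictive n hn A hA
    have h1 : ∫ ω in past X n ⁻¹' S, (P⟦X n ⁻¹' A | pastSigma X n⟧) ω ∂P
        = ∫ ω in past X n ⁻¹' S, (X n ⁻¹' A).indicator (fun _ => (1 : ℝ)) ω ∂P :=
      setIntegral_condExp hle ((integrable_const _).indicator (hXn hA)) hT
    have h2 : ∀ ω, (θ * ν.real A + ∑ i ∈ Finset.range n, (R (X i ω)).real A) /
        (θ + ∑ i ∈ Finset.range n, (R (X i ω)).real Set.univ)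
        = (urnKernel θ ν R n (past X n ω)).real A := fun ω => by
      rw [hX.urnKernel_real, Finset.sum_range, Finset.sum_range]
      rfl
    rw [integral_congr_ae (ae_restrict_of_ae hpre), integral_indicator (hXn hA)] at h1
    simp only [h2, integral_const, measureReal_restrict_apply MeasurableSet.univ, smul_eq_mul,
      mul_one, Set.univ_inter] at h1
    rw [measureReal_restrict_apply (hXn hA)] at h1
    have h3 : ∫ ω in past X n ⁻¹' S, (urnKernel θ ν R n (past X n ω)).real A ∂P
        = (∫⁻ ω in past X n ⁻¹' S, urnKernel θ ν R n (past X n ω) A ∂P).toReal := by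
      refine integral_toReal ?_ (ae_of_all _ fun ω => measure_lt_top _ _)
      exact (((urnKernel θ ν R n).measurable_coe hA).comp hp).aemeasurable
    rw [h3, measureReal_def] at h1
    rw [← Set.inter_comm, Set.mk_preimage_prod, Set.inter_comm] at *
    refine ((ENNReal.toReal_eq_toReal_iff' ?_ (measure_ne_top _ _)).1 h1).symm
    refine ((lintegral_mono fun ω => prob_le_one).trans_lt ?_).ne
    simp

end IsMVPS

end Pred

/-! ### Bounded measurable test functions -/

section BoundedMeasurable

variable {α β : Type*} [MeasurableSpace α] [MeasurableSpace β]

/-- Bounded measurable real functions. -/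
structure BddMeas (f : α → ℝ) : Prop where
  meas : Measurable f
  bdd : ∃ C, ∀ x, |f x| ≤ C

namespace BddMeas

variable {f g : α → ℝ}

lemma of_le {C : ℝ} (hf : Measurable f) (h : ∀ x, |f x| ≤ C) : BddMeas f := ⟨hf, C, h⟩

lemma const (c : ℝ) : BddMeas fun _ : α => c := ⟨measurable_const, |c|, fun _ => le_rfl⟩

lemma add (hf : BddMeas f) (hg : BddMeas g) : BddMeas fun x => f x + g x := by
  obtain ⟨C, hC⟩ := hf.bdd
  obtain ⟨D, hD⟩ := hg.bdd
  exact ⟨hf.meas.add hg.meas, C + D, fun x => (abs_add_le _ _).trans (add_le_add (hC x) (hD x))⟩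

lemma mul (hf : BddMeas f) (hg : BddMeas g) : BddMeas fun x => f x * g x := by
  obtain ⟨C, hC⟩ := hf.bdd
  obtain ⟨D, hD⟩ := hg.bdd
  refine ⟨hf.meas.mul hg.meas, C * D, fun x => ?_⟩
  rw [abs_mul]
  exact mul_le_mul (hC x) (hD x) (abs_nonneg _) ((abs_nonneg _).trans (hC x))

lemma neg (hf : BddMeas f) : BddMeas fun x => - f x := by
  simpa using (const (-1)).mul hf

lemma sub (hf : BddMeas f) (hg : BddMeas g) : BddMeas fun x => f x - g x := by
  simpa [sub_eq_add_neg] using hf.add hg.neg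

lemma const_mul (c : ℝ) (hf : BddMeas f) : BddMeas fun x => c * f x := (const c).mul hf

lemma comp (hf : BddMeas f) {φ : β → α} (hφ : Measurable φ) : BddMeas fun x => f (φ x) := by
  obtain ⟨C, hC⟩ := hf.bdd
  exact ⟨hf.meas.comp hφ, C, fun x => hC _⟩

lemma indicator_one {A : Set α} (hA : MeasurableSet A) :
    BddMeas (A.indicator fun _ => (1 : ℝ)) := by
  refine ⟨measurable_const.indicator hA, 1, fun x => ?_⟩
  by_cases hx : x ∈ A <;> simp [hx]

lemma integrable (hf : BddMeas f) (μ : Measure α) [IsFiniteMeasure μ] : Integrable f μ := by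
  obtain ⟨C, hC⟩ := hf.bdd
  exact Integrable.of_bound hf.meas.aestronglyMeasurable C (ae_of_all _ fun x => hC x)

lemma integral_add (hf : BddMeas f) (hg : BddMeas g) (μ : Measure α) [IsFiniteMeasure μ] :
    ∫ x, f x + g x ∂μ = ∫ x, f x ∂μ + ∫ x, g x ∂μ :=
  MeasureTheory.integral_add (hf.integrable μ) (hg.integrable μ)

lemma integral_sub (hf : BddMeas f) (hg : BddMeas g) (μ : Measure α) [IsFiniteMeasure μ] :
    ∫ x, f x - g x ∂μ = ∫ x, f x ∂μ - ∫ x, g x ∂μ :=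
  MeasureTheory.integral_sub (hf.integrable μ) (hg.integrable μ)

lemma kernel_integral {f : β → ℝ} (hf : BddMeas f) (κ : Kernel α β) [IsMarkovKernel κ] :
    BddMeas fun x => ∫ y, f y ∂κ x := by
  obtain ⟨C, hC⟩ := hf.bdd
  refine ⟨(hf.meas.stronglyMeasurable.integral_kernel (κ := κ)).measurable, C, fun x => ?_⟩
  rw [← Real.norm_eq_abs]
  simpa using norm_integral_le_of_norm_le_const (μ := κ x)
    (ae_of_all _ fun y => (Real.norm_eq_abs (f y)).le.trans (hC y))

end BddMeas

end BoundedMeasurable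

lemma IsExchangeable.integral_perm {Ω 𝕏 : Type*} [MeasurableSpace Ω] [MeasurableSpace 𝕏]
    {P : Measure Ω} {X : ℕ → Ω → 𝕏} (hE : IsExchangeable P X) (hX : ∀ n, Measurable (X n))
    {n : ℕ} (σ : Equiv.Perm (Fin n)) {F : (Fin n → 𝕏) → ℝ} (hF : Measurable F) :
    ∫ ω, F (fun i => X (σ i) ω) ∂P = ∫ ω, F (fun i => X i ω) ∂P := by
  have h1 : Measurable fun ω (i : Fin n) => X (σ i) ω := measurable_pi_lambda _ fun i => hX _
  have h2 : Measurable fun ω (i : Fin n) => X i ω := measurable_pi_lambda _ fun i => hX _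
  rw [← integral_map (φ := fun ω (i : Fin n) => X (σ i) ω) h1.aemeasurable
    hF.aestronglyMeasurable, hE n σ, integral_map h2.aemeasurable hF.aestronglyMeasurable]

/-! ### Expectations of two and three observations -/

section Identities

variable {Ω 𝕏 : Type*} [mΩ : MeasurableSpace Ω] [m𝕏 : MeasurableSpace 𝕏]

/-- The predictive kernel given one observation. -/
noncomputable def stepKernel (θ : ℝ) (ν : Measure 𝕏) (R : Kernel 𝕏 𝕏) : Kernel 𝕏 𝕏 :=
  (urnKernel θ ν R 1).comap (fun x _ => x) (measurable_pi_lambda _ fun _ => measurable_id)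

/-- The total mass `θ + R_x(𝕏)` of the urn after the observation `x`. -/
noncomputable def urnMass (θ : ℝ) (R : Kernel 𝕏 𝕏) (x : 𝕏) : ℝ := θ + (R x).real Set.univ

namespace IsMVPS

variable {P : Measure Ω} {X : ℕ → Ω → 𝕏} {θ : ℝ} {ν : Measure 𝕏}
  {R : Kernel 𝕏 𝕏}

lemma urnMass_pos (hX : IsMVPS P X θ ν R) (x : 𝕏) : 0 < urnMass θ R x :=
  add_pos_of_pos_of_nonneg hX.theta_pos measureReal_nonneg

lemma measurable_urnMass : Measurable (urnMass θ R) :=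
  measurable_const.add (R.measurable_coe MeasurableSet.univ).ennreal_toReal

lemma isMarkovKernel_stepKernel (hX : IsMVPS P X θ ν R) : IsMarkovKernel (stepKernel θ ν R) := by
  have := hX.isMarkovKernel 1
  unfold stepKernel
  infer_instance

lemma isFiniteMeasure_kernel (hX : IsMVPS P X θ ν R) (x : 𝕏) : IsFiniteMeasure (R x) :=
  ⟨hX.finite_kernel x⟩

lemma integral_urnKernel (hX : IsMVPS P X θ ν R) {n : ℕ} (x : Fin n → 𝕏) {b : 𝕏 → ℝ}
    (hb : BddMeas b) :
    (θ + ∑ i, (R (x i)).real Set.univ) * ∫ y, b y ∂urnKernel θ ν R n x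
      = θ * ∫ y, b y ∂ν + ∑ i, ∫ y, b y ∂(R (x i)) := by
  have := hX.isProbabilityMeasure
  have := hX.isFiniteMeasure_kernel
  have h := hX.urnMeasure_real x Set.univ
  rw [probReal_univ (μ := ν), mul_one] at h
  have hm : (urnMeasure θ ν R x).real Set.univ ≠ 0 :=
    (ENNReal.toReal_pos (hX.urnMeasure_univ_ne_zero x) (hX.urnMeasure_univ_ne_top x)).ne'
  rw [urnKernel_apply, integral_smul_measure, ENNReal.toReal_inv, ← measureReal_def, ← h,
    smul_eq_mul, mul_inv_cancel_left₀ hm, urnMeasure, integral_add_measure,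
    integral_smul_measure, ENNReal.toReal_ofReal hX.theta_pos.le, integral_finsetSum_measure,
    smul_eq_mul]
  · exact fun i _ => hb.integrable _
  · exact (hb.integrable _).smul_measure ENNReal.ofReal_ne_top
  · exact integrable_finsetSum_measure.2 fun i _ => hb.integrable _

lemma integral_stepKernel (hX : IsMVPS P X θ ν R) (x : 𝕏) {b : 𝕏 → ℝ} (hb : BddMeas b) :
    urnMass θ R x * ∫ y, b y ∂stepKernel θ ν R x = θ * ∫ y, b y ∂ν + ∫ y, b y ∂(R x) := by
  simpa [urnMass, stepKernel, Kernel.comap_apply] using hX.integral_urnKernel (n := 1)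
    (fun _ => x) hb

lemma integral_zero (hX : IsMVPS P X θ ν R) {f : 𝕏 → ℝ} (hf : Measurable f) :
    ∫ ω, f (X 0 ω) ∂P = ∫ x, f x ∂ν := by
  rw [← hX.law_zero, integral_map (hX.measurable 0).aemeasurable hf.aestronglyMeasurable]

variable [IsProbabilityMeasure P]

lemma integral_pred (hX : IsMVPS P X θ ν R) (n : ℕ) {F : (Fin n → 𝕏) × 𝕏 → ℝ}
    (hF : BddMeas F) :
    ∫ ω, F (past X n ω, X n ω) ∂P
      = ∫ ω, ∫ y, F (past X n ω, y) ∂urnKernel θ ν R n (past X n ω) ∂P := by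
  have := hX.isMarkovKernel n
  have hp := hX.measurable_past n
  have := Measure.isProbabilityMeasure_map (μ := P) hp.aemeasurable
  rw [← integral_map (φ := fun ω => (past X n ω, X n ω)) (hp.prodMk (hX.measurable n)).aemeasurable
    hF.meas.aestronglyMeasurable, hX.map_past_prod n, Measure.integral_compProd (hF.integrable _),
    integral_map hp.aemeasurable]
  exact (StronglyMeasurable.integral_kernel_prod_right' (κ := urnKernel θ ν R n)
    hF.meas.stronglyMeasurable).aestronglyMeasurable

lemma integral_one (hX : IsMVPS P X θ ν R) {F : 𝕏 × 𝕏 → ℝ} (hF : BddMeas F) :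
    ∫ ω, F (X 0 ω, X 1 ω) ∂P = ∫ x, ∫ y, F (x, y) ∂stepKernel θ ν R x ∂ν := by
  have := hX.isMarkovKernel_stepKernel
  have h := hX.integral_pred 1 (F := fun q => F (q.1 0, q.2)) (hF.comp (by fun_prop))
  refine h.trans ?_
  rw [← hX.integral_zero (f := fun x => ∫ y, F (x, y) ∂stepKernel θ ν R x)]
  · refine integral_congr_ae (ae_of_all _ fun ω => ?_)
    have : past X 1 ω = fun _ => X 0 ω := by
      funext i
      rw [Subsingleton.elim i 0]
      rfl
    simp only [stepKernel, Kernel.comap_apply, this]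
  · exact (StronglyMeasurable.integral_kernel_prod_right' (κ := stepKernel θ ν R)
      hF.meas.stronglyMeasurable).measurable

lemma integral_one_mul (hX : IsMVPS P X θ ν R) {a b : 𝕏 → ℝ} (ha : BddMeas a) (hb : BddMeas b) :
    ∫ ω, a (X 0 ω) * b (X 1 ω) ∂P = ∫ x, a x * ∫ y, b y ∂stepKernel θ ν R x ∂ν := by
  rw [hX.integral_one (F := fun q => a q.1 * b q.2)
    ((ha.comp measurable_fst).mul (hb.comp measurable_snd))]
  simp only [integral_const_mul]

/-- The urn after two draws has mass ℓ(X₀) + ℓ(X₁) − θ, because the initial urn is counted in both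
ℓ's; the same correction appears in the numerator. The third predictive law is thus expressed
through the one-step operator alone. -/
lemma integral_two (hX : IsMVPS P X θ ν R) {F : 𝕏 × 𝕏 → ℝ} {b : 𝕏 → ℝ} (hF : BddMeas F)
    (hb : BddMeas b) :
    ∫ ω, F (X 0 ω, X 1 ω) * b (X 2 ω) ∂P
      = ∫ ω, F (X 0 ω, X 1 ω) * ((urnMass θ R (X 0 ω) * ∫ y, b y ∂stepKernel θ ν R (X 0 ω)
        + urnMass θ R (X 1 ω) * ∫ y, b y ∂stepKernel θ ν R (X 1 ω) - θ * ∫ y, b y ∂ν)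
        / (urnMass θ R (X 0 ω) + urnMass θ R (X 1 ω) - θ)) ∂P := by
  have h := hX.integral_pred 2 (F := fun q => F (q.1 0, q.1 1) * b q.2)
    ((hF.comp (by fun_prop)).mul (hb.comp (by fun_prop)))
  refine h.trans (integral_congr_ae (ae_of_all _ fun ω => ?_))
  simp only [integral_const_mul]
  congr 1
  have h2 := hX.integral_urnKernel (past X 2 ω) hb
  rw [hX.integral_stepKernel _ hb, hX.integral_stepKernel _ hb, eq_div_iff]
  · simp only [Fin.sum_univ_two, past, Fin.val_zero, Fin.val_one] at h2
    simp only [urnMass]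
    linear_combination h2
  · have h0 := hX.urnMass_pos (X 0 ω)
    have h1 : θ ≤ urnMass θ R (X 1 ω) := le_add_of_nonneg_right measureReal_nonneg
    linarith

end IsMVPS

end Identities

/-! ### Identities forced by exchangeability of three observations -/

section Exchangeable

variable {Ω 𝕏 : Type*} [mΩ : MeasurableSpace Ω] [m𝕏 : MeasurableSpace 𝕏]

/-- The transition operator `f ↦ E[f(X₁) | X₀ = ·]`. -/
noncomputable def stepOp (θ : ℝ) (ν : Measure 𝕏) (R : Kernel 𝕏 𝕏) (f : 𝕏 → ℝ) (x : 𝕏) : ℝ :=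
  ∫ y, f y ∂stepKernel θ ν R x

namespace IsMVPS

variable {P : Measure Ω} {X : ℕ → Ω → 𝕏} {θ : ℝ} {ν : Measure 𝕏}
  {R : Kernel 𝕏 𝕏}

lemma bddMeas_stepOp (hX : IsMVPS P X θ ν R) {f : 𝕏 → ℝ} (hf : BddMeas f) :
    BddMeas (stepOp θ ν R f) :=
  have := hX.isMarkovKernel_stepKernel
  hf.kernel_integral (stepKernel θ ν R)

lemma integral_swap (hX : IsMVPS P X θ ν R) (hE : IsExchangeable P X) {F : 𝕏 → 𝕏 → ℝ}
    (hF : Measurable fun q : 𝕏 × 𝕏 => F q.1 q.2) :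
    ∫ ω, F (X 0 ω) (X 1 ω) ∂P = ∫ ω, F (X 1 ω) (X 0 ω) ∂P := by
  have h := hE.integral_perm hX.measurable (n := 2) (Equiv.swap 0 1) (F := fun x => F (x 0) (x 1))
    (hF.comp (g := fun q : 𝕏 × 𝕏 => F q.1 q.2) (f := fun x : Fin 2 → 𝕏 => (x 0, x 1))
      (by fun_prop))
  simpa using h.symm

lemma integral_mul_swap_left (hX : IsMVPS P X θ ν R) (hE : IsExchangeable P X) {f a b : 𝕏 → ℝ}
    (hf : Measurable f) (ha : Measurable a) (hb : Measurable b) :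
    ∫ ω, f (X 0 ω) * a (X 1 ω) * b (X 2 ω) ∂P = ∫ ω, a (X 0 ω) * f (X 1 ω) * b (X 2 ω) ∂P := by
  have h := hE.integral_perm hX.measurable (n := 3) (Equiv.swap 0 1)
    (F := fun x => f (x 0) * a (x 1) * b (x 2)) (by fun_prop)
  have h2 : (Equiv.swap (0 : Fin 3) 1) 2 = 2 := by decide
  simp only [Equiv.swap_apply_left, Equiv.swap_apply_right, h2, Fin.val_zero, Fin.val_one,
    Fin.val_two] at h
  rw [← h]
  simp only [mul_comm (f _)]

lemma integral_mul_swap_right (hX : IsMVPS P X θ ν R) (hE : IsExchangeable P X) {f a b : 𝕏 → ℝ}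
    (hf : Measurable f) (ha : Measurable a) (hb : Measurable b) :
    ∫ ω, f (X 0 ω) * a (X 1 ω) * b (X 2 ω) ∂P = ∫ ω, f (X 0 ω) * b (X 1 ω) * a (X 2 ω) ∂P := by
  have h := hE.integral_perm hX.measurable (n := 3) (Equiv.swap 1 2)
    (F := fun x => f (x 0) * a (x 1) * b (x 2)) (by fun_prop)
  have h2 : (Equiv.swap (1 : Fin 3) 2) 0 = 0 := by decide
  simp only [Equiv.swap_apply_left, Equiv.swap_apply_right, h2, Fin.val_zero, Fin.val_one,
    Fin.val_two] at h
  rw [← h]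
  simp only [mul_right_comm (f _) (b _)]

lemma theta_le_urnMass_add_sub (x y : 𝕏) :
    θ ≤ urnMass θ R x + urnMass θ R y - θ := by
  have h0 : θ ≤ urnMass θ R x := le_add_of_nonneg_right measureReal_nonneg
  have h1 : θ ≤ urnMass θ R y := le_add_of_nonneg_right measureReal_nonneg
  linarith

lemma bddMeas_pred_two (hX : IsMVPS P X θ ν R) {f : 𝕏 → ℝ} (hf : BddMeas f) :
    BddMeas fun q : 𝕏 × 𝕏 => (urnMass θ R q.1 * stepOp θ ν R f q.1
      + urnMass θ R q.2 * stepOp θ ν R f q.2 - θ * ∫ y, f y ∂ν)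
        / (urnMass θ R q.1 + urnMass θ R q.2 - θ) := by
  have := hX.isProbabilityMeasure
  have := (hX.bddMeas_stepOp hf).meas
  have hm : Measurable (urnMass θ R) := measurable_urnMass
  obtain ⟨C, hC⟩ := (hX.bddMeas_stepOp hf).bdd
  -- With |K f| ≤ C and N = ℓ(x) + ℓ(y) − θ ≥ θ, the numerator is at most C(N + θ) + θ|∫ f| ≤ N(2C +
  -- |∫ f|). This needs no bound on the masses themselves.
  refine BddMeas.of_le (C := 2 * C + |∫ y, f y ∂ν|) (by fun_prop) fun q => ?_
  have hN := theta_le_urnMass_add_sub (θ := θ) (R := R) q.1 q.2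
  have hθ := hX.theta_pos
  have h1 := hX.urnMass_pos q.1
  have h2 := hX.urnMass_pos q.2
  have hC0 : 0 ≤ C := (abs_nonneg _).trans (hC q.1)
  rw [abs_div, abs_of_pos (hθ.trans_le hN), div_le_iff₀ (hθ.trans_le hN)]
  refine (abs_sub _ _).trans ((add_le_add_left (abs_add_le _ _) _).trans ?_)
  rw [abs_mul, abs_mul, abs_mul, abs_of_pos h1, abs_of_pos h2, abs_of_pos hθ]
  have k1 := mul_le_mul_of_nonneg_left (hC q.1) h1.le
  have k2 := mul_le_mul_of_nonneg_left (hC q.2) h2.le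
  have k3 := mul_le_mul_of_nonneg_right hN (abs_nonneg (∫ y, f y ∂ν))
  have k4 := mul_le_mul_of_nonneg_left hN hC0
  linarith

variable [IsProbabilityMeasure P]

/-- Reversibility of the transition operator with respect to `ν`. -/
lemma stepOp_symm (hX : IsMVPS P X θ ν R) (hE : IsExchangeable P X) {a b : 𝕏 → ℝ}
    (ha : BddMeas a) (hb : BddMeas b) :
    ∫ x, a x * stepOp θ ν R b x ∂ν = ∫ x, b x * stepOp θ ν R a x ∂ν := by
  have := ha.meas
  have := hb.meas
  have h1 := hX.integral_one_mul ha hb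
  have h2 := hX.integral_one_mul hb ha
  have h3 := hX.integral_swap hE (F := fun x y => a x * b y) (by fun_prop)
  simp only [mul_comm (a _)] at h3
  simp only [mul_comm (a _) (b _)] at h1
  exact h1.symm.trans (h3.trans h2)

/-- Multiplying by ℓ(X₀) + ℓ(X₁) − θ cancels the denominator of the third predictive law, after
which only one-step expectations remain. Boundedness of ℓ·f and ℓ·a keeps every term integrable. -/
lemma triple_identity (hX : IsMVPS P X θ ν R) {f a b : 𝕏 → ℝ}
    (hf : BddMeas f) (hlf : BddMeas fun x => urnMass θ R x * f x)
    (ha : BddMeas a) (hla : BddMeas fun x => urnMass θ R x * a x) (hb : BddMeas b) :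
    ∫ ω, (urnMass θ R (X 0 ω) * f (X 0 ω)) * a (X 1 ω) * b (X 2 ω) ∂P
      + ∫ ω, f (X 0 ω) * (urnMass θ R (X 1 ω) * a (X 1 ω)) * b (X 2 ω) ∂P
      - θ * ∫ ω, f (X 0 ω) * a (X 1 ω) * b (X 2 ω) ∂P
    = ∫ x, urnMass θ R x * f x * stepOp θ ν R b x * stepOp θ ν R a x ∂ν
      + ∫ x, f x * stepOp θ ν R (fun y => urnMass θ R y * a y * stepOp θ ν R b y) x ∂ν
      - θ * (∫ x, f x * stepOp θ ν R a x ∂ν) * ∫ x, b x ∂ν := by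
  have m0 := hX.measurable 0
  have m1 := hX.measurable 1
  have m2 := hX.measurable 2
  have hPb := hX.bddMeas_stepOp hb
  have i1 := ((((hlf.comp m0).mul (ha.comp m1)).mul (hb.comp m2)))
  have i2 := ((((hf.comp m0).mul (hla.comp m1)).mul (hb.comp m2)))
  have i3 := (((((hf.comp m0).mul (ha.comp m1)).mul (hb.comp m2))).const_mul θ)
  have hF : BddMeas fun q : 𝕏 × 𝕏 => urnMass θ R q.1 * f q.1 * a q.2
      + f q.1 * (urnMass θ R q.2 * a q.2) - θ * (f q.1 * a q.2) :=
    (((hlf.comp measurable_fst).mul (ha.comp measurable_snd)).add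
      ((hf.comp measurable_fst).mul (hla.comp measurable_snd))).sub
      (((hf.comp measurable_fst).mul (ha.comp measurable_snd)).const_mul θ)
  have h := hX.integral_two hF hb
  rw [← integral_const_mul, ← i1.integral_add i2, ← (i1.add i2).integral_sub i3]
  have e1 : ∀ ω, urnMass θ R (X 0 ω) * f (X 0 ω) * a (X 1 ω) * b (X 2 ω)
      + f (X 0 ω) * (urnMass θ R (X 1 ω) * a (X 1 ω)) * b (X 2 ω)
      - θ * (f (X 0 ω) * a (X 1 ω) * b (X 2 ω))
      = (urnMass θ R (X 0 ω) * f (X 0 ω) * a (X 1 ω)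
      + f (X 0 ω) * (urnMass θ R (X 1 ω) * a (X 1 ω)) - θ * (f (X 0 ω) * a (X 1 ω)))
      * b (X 2 ω) := fun ω => by ring
  simp only [e1]
  rw [h]
  have e2 : ∀ ω, (urnMass θ R (X 0 ω) * f (X 0 ω) * a (X 1 ω)
      + f (X 0 ω) * (urnMass θ R (X 1 ω) * a (X 1 ω)) - θ * (f (X 0 ω) * a (X 1 ω)))
      * ((urnMass θ R (X 0 ω) * ∫ y, b y ∂stepKernel θ ν R (X 0 ω)
        + urnMass θ R (X 1 ω) * ∫ y, b y ∂stepKernel θ ν R (X 1 ω) - θ * ∫ y, b y ∂ν)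
        / (urnMass θ R (X 0 ω) + urnMass θ R (X 1 ω) - θ))
      = (urnMass θ R (X 0 ω) * f (X 0 ω) * stepOp θ ν R b (X 0 ω)) * a (X 1 ω)
        + f (X 0 ω) * (urnMass θ R (X 1 ω) * a (X 1 ω) * stepOp θ ν R b (X 1 ω))
        - θ * (∫ y, b y ∂ν) * (f (X 0 ω) * a (X 1 ω)) := fun ω => by
    have hN : urnMass θ R (X 0 ω) + urnMass θ R (X 1 ω) - θ ≠ 0 :=
      (hX.theta_pos.trans_le (theta_le_urnMass_add_sub (θ := θ) (R := R) _ _)).ne'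
    simp only [stepOp]
    field_simp
  simp only [e2]
  have j1 := ((hlf.mul hPb).comp m0).mul (ha.comp m1)
  have j2 := (hf.comp m0).mul ((hla.mul hPb).comp m1)
  have j3 := ((hf.comp m0).mul (ha.comp m1)).const_mul (θ * ∫ y, b y ∂ν)
  rw [(j1.add j2).integral_sub j3, j1.integral_add j2, integral_const_mul,
    hX.integral_one_mul (hlf.mul hPb) ha, hX.integral_one_mul hf (hla.mul hPb),
    hX.integral_one_mul hf ha]
  simp only [stepOp]
  ring

/-- The exchangeability of three observations, as an identity for two of them. -/
lemma pair_identity (hX : IsMVPS P X θ ν R) (hE : IsExchangeable P X) {f a b : 𝕏 → ℝ}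
    (hf : BddMeas f) (hlf : BddMeas fun x => urnMass θ R x * f x)
    (ha : BddMeas a) (hla : BddMeas fun x => urnMass θ R x * a x)
    (hb : BddMeas b) (hlb : BddMeas fun x => urnMass θ R x * b x) :
    ∫ ω, a (X 0 ω) * b (X 1 ω) *
      (urnMass θ R (X 0 ω) * stepOp θ ν R f (X 0 ω) - urnMass θ R (X 1 ω) * stepOp θ ν R f (X 1 ω)
      - (urnMass θ R (X 0 ω) - urnMass θ R (X 1 ω)) *
        ((urnMass θ R (X 0 ω) * stepOp θ ν R f (X 0 ω)
          + urnMass θ R (X 1 ω) * stepOp θ ν R f (X 1 ω) - θ * ∫ y, f y ∂ν)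
        / (urnMass θ R (X 0 ω) + urnMass θ R (X 1 ω) - θ))) ∂P
    = θ * ((∫ x, a x * stepOp θ ν R f x ∂ν) * (∫ x, b x ∂ν)
      - (∫ x, b x * stepOp θ ν R f x ∂ν) * ∫ x, a x ∂ν) := by
  have m0 := hX.measurable 0
  have m1 := hX.measurable 1
  have m2 := hX.measurable 2
  have hPf := hX.bddMeas_stepOp hf
  have hPa := hX.bddMeas_stepOp ha
  have hPb := hX.bddMeas_stepOp hb
  -- Subtracting the identity for (f, b, a) from that for (f, a, b) leaves only the terms with ℓ·a,
  -- ℓ·b and the product terms. Reversibility moves K from ℓ·a·K b to f, and permuting the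
  -- observations puts f in third place, where its expectation given the first two is the predictive
  -- quotient.
  have t1 := hX.triple_identity hf hlf ha hla hb
  have t2 := hX.triple_identity hf hlf hb hlb ha
  have s1 := hX.integral_mul_swap_right hE hlf.meas ha.meas hb.meas
  have s2 := hX.integral_mul_swap_right hE hf.meas ha.meas hb.meas
  have s3 := hX.stepOp_symm hE hf (hla.mul hPb)
  have s4 := hX.stepOp_symm hE hf (hlb.mul hPa)
  have s5 := hX.stepOp_symm hE hf ha
  have s6 := hX.stepOp_symm hE hf hb
  have c1 : ∫ x, urnMass θ R x * f x * stepOp θ ν R b x * stepOp θ ν R a x ∂ν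
      = ∫ x, urnMass θ R x * f x * stepOp θ ν R a x * stepOp θ ν R b x ∂ν :=
    integral_congr_ae (ae_of_all _ fun x => by ring)
  -- the two sides as expectations of functions of two observations
  have u1 := (hX.integral_mul_swap_left hE hf.meas hla.meas hb.meas).trans
    (hX.integral_mul_swap_right hE hla.meas hf.meas hb.meas)
  have v1 := ((hX.integral_mul_swap_right hE hf.meas hlb.meas ha.meas).trans
    (hX.integral_mul_swap_left hE hf.meas ha.meas hlb.meas)).trans
    (hX.integral_mul_swap_right hE ha.meas hf.meas hlb.meas)
  have w1 := hX.integral_two (F := fun q => urnMass θ R q.1 * a q.1 * b q.2)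
    ((hla.comp measurable_fst).mul (hb.comp measurable_snd)) hf
  have w2 := hX.integral_two (F := fun q => a q.1 * (urnMass θ R q.2 * b q.2))
    ((ha.comp measurable_fst).mul (hlb.comp measurable_snd)) hf
  have x1 := hX.integral_one_mul (hla.mul hPf) hb
  have x2 := hX.integral_one_mul (hlb.mul hPf) ha
  have x3 := hX.integral_swap hE
    (F := fun x y => urnMass θ R x * b x * stepOp θ ν R f x * a y)
    ((((hlb.mul hPf).comp measurable_fst).mul (ha.comp measurable_snd)).meas)
  have hQ := (hX.bddMeas_pred_two hf).comp (m0.prodMk m1)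
  have b1 := ((hla.mul hPf).comp m0).mul (hb.comp m1)
  have b2 := (ha.comp m0).mul ((hlb.mul hPf).comp m1)
  have b3 := ((hla.comp m0).mul (hb.comp m1)).mul hQ
  have b4 := ((ha.comp m0).mul (hlb.comp m1)).mul hQ
  have e : ∫ ω, a (X 0 ω) * b (X 1 ω) *
      (urnMass θ R (X 0 ω) * stepOp θ ν R f (X 0 ω) - urnMass θ R (X 1 ω) * stepOp θ ν R f (X 1 ω)
      - (urnMass θ R (X 0 ω) - urnMass θ R (X 1 ω)) *
        ((urnMass θ R (X 0 ω) * stepOp θ ν R f (X 0 ω)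
          + urnMass θ R (X 1 ω) * stepOp θ ν R f (X 1 ω) - θ * ∫ y, f y ∂ν)
        / (urnMass θ R (X 0 ω) + urnMass θ R (X 1 ω) - θ))) ∂P = _ :=
    (integral_congr_ae (ae_of_all _ fun ω => by simp only; ring)).trans
      (((b1.sub b2).integral_sub (b3.sub b4) P).trans (congrArg₂ (· - ·)
        (b1.integral_sub b2 P) (b3.integral_sub b4 P)))
  have c2 : ∫ x, urnMass θ R x * a x * stepOp θ ν R b x * stepOp θ ν R f x ∂ν
      = ∫ x, urnMass θ R x * a x * stepOp θ ν R f x * stepOp θ ν R b x ∂ν :=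
    integral_congr_ae (ae_of_all _ fun x => by ring)
  have c3 : ∫ x, urnMass θ R x * b x * stepOp θ ν R a x * stepOp θ ν R f x ∂ν
      = ∫ x, urnMass θ R x * b x * stepOp θ ν R f x * stepOp θ ν R a x ∂ν :=
    integral_congr_ae (ae_of_all _ fun x => by ring)
  rw [e]
  rw [s5, s3, c2, s2] at t1
  rw [s6, s4, c3] at t2
  clear s3 s4 s5 s6 c2 c3 e
  simp only [stepOp] at *
  simp only [mul_comm, mul_left_comm] at *
  linarith

end IsMVPS

end Exchangeable

/-! ### Light against heavy colours -/

section Dichotomy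

variable {Ω 𝕏 : Type*} [mΩ : MeasurableSpace Ω] [m𝕏 : MeasurableSpace 𝕏]

/-- The centred transition operator. -/
noncomputable def stepDev (θ : ℝ) (ν : Measure 𝕏) (R : Kernel 𝕏 𝕏) (f : 𝕏 → ℝ) (x : 𝕏) : ℝ :=
  stepOp θ ν R f x - ∫ y, f y ∂ν

lemma stepDev_neg (θ : ℝ) (ν : Measure 𝕏) (R : Kernel 𝕏 𝕏) (f : 𝕏 → ℝ) (x : 𝕏) :
    stepDev θ ν R (fun y => - f y) x = - stepDev θ ν R f x := by
  simp only [stepDev, stepOp, integral_neg]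
  ring

namespace IsMVPS

variable {P : Measure Ω} {X : ℕ → Ω → 𝕏} {θ : ℝ} {ν : Measure 𝕏}
  {R : Kernel 𝕏 𝕏}

lemma bddMeas_stepDev (hX : IsMVPS P X θ ν R) {f : 𝕏 → ℝ} (hf : BddMeas f) :
    BddMeas (stepDev θ ν R f) :=
  (hX.bddMeas_stepOp hf).sub (.const _)

/-- The initial content θν is still in the urn after a draw. This minorization is what compares the
joint law of the first two observations with ν ⊗ ν. -/
lemma theta_mul_integral_le (hX : IsMVPS P X θ ν R) (x : 𝕏) {f : 𝕏 → ℝ} (hf : BddMeas f)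
    (h0 : ∀ y, 0 ≤ f y) :
    θ / urnMass θ R x * ∫ y, f y ∂ν ≤ ∫ y, f y ∂stepKernel θ ν R x := by
  have h := hX.integral_stepKernel x hf
  have h1 : 0 ≤ ∫ y, f y ∂(R x) := integral_nonneg h0
  rw [div_mul_eq_mul_div, div_le_iff₀ (hX.urnMass_pos x)]
  linarith

variable [IsProbabilityMeasure P]

/-- Let F be the integrand of `pair_identity`. Its expectation equals θ ∫ a b (D f(x) − D f(y)) d(ν
⊗ ν), while the minorization bounds it below by θ ∫ F / ℓ(x) d(ν ⊗ ν). The sign hypotheses make F /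
ℓ(x) at least a b (D f(x) − D f(y)) pointwise, so equality holds a.e. The explicit difference is a b
times a positive multiple of D f(x) − D f(y) (ℓ(x) − θ)/ℓ(x), whose two terms are nonnegative and
must both vanish. -/
lemma ae_stepDev_eq_zero_of_mul_ne_zero (hX : IsMVPS P X θ ν R) (hE : IsExchangeable P X)
    {f a b : 𝕏 → ℝ} (hf : BddMeas f) (hlf : BddMeas fun x => urnMass θ R x * f x)
    (ha : BddMeas a) (hla : BddMeas fun x => urnMass θ R x * a x)
    (hb : BddMeas b) (hlb : BddMeas fun x => urnMass θ R x * b x)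
    (ha0 : ∀ x, 0 ≤ a x) (hb0 : ∀ x, 0 ≤ b x)
    (hab : ∀ x y, a x ≠ 0 → b y ≠ 0 → θ < urnMass θ R x ∧ urnMass θ R x < urnMass θ R y ∧
      0 ≤ stepDev θ ν R f x ∧ stepDev θ ν R f y ≤ 0) :
    ∀ᵐ q ∂ν.prod ν, a q.1 ≠ 0 → b q.2 ≠ 0 →
      stepDev θ ν R f q.1 = 0 ∧ stepDev θ ν R f q.2 = 0 := by
  have := hX.isProbabilityMeasure
  have := hX.isMarkovKernel_stepKernel
  have hθ := hX.theta_pos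
  have hl : Measurable (urnMass θ R) := measurable_urnMass
  have hPf := hX.bddMeas_stepOp hf
  have hQ := hX.bddMeas_pred_two hf
  have hid := hX.pair_identity hE hf hlf ha hla hb hlb
  have hinv : BddMeas fun x => (urnMass θ R x)⁻¹ := by
    refine BddMeas.of_le (C := θ⁻¹) (by fun_prop) fun x => ?_
    rw [abs_of_pos (inv_pos.2 (hX.urnMass_pos x))]
    exact inv_anti₀ hθ (le_add_of_nonneg_right measureReal_nonneg)
  set c := ∫ y, f y ∂ν with hc
  set F : 𝕏 × 𝕏 → ℝ := fun q => a q.1 * b q.2 *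
      (urnMass θ R q.1 * stepOp θ ν R f q.1 - urnMass θ R q.2 * stepOp θ ν R f q.2
      - (urnMass θ R q.1 - urnMass θ R q.2) *
        ((urnMass θ R q.1 * stepOp θ ν R f q.1
          + urnMass θ R q.2 * stepOp θ ν R f q.2 - θ * c)
        / (urnMass θ R q.1 + urnMass θ R q.2 - θ))) with hFdef
  have hF : BddMeas F := by
    have b1 := (((hla.mul hPf).comp measurable_fst).mul (hb.comp measurable_snd)).sub
      ((ha.comp measurable_fst).mul ((hlb.mul hPf).comp measurable_snd))
    have b2 := (((hla.comp measurable_fst).mul (hb.comp measurable_snd)).sub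
      ((ha.comp measurable_fst).mul (hlb.comp measurable_snd))).mul hQ
    convert b1.sub b2 using 1
    funext q
    simp only [hFdef]
    ring
  -- the integrand in terms of the deviations
  have hdiff : ∀ q : 𝕏 × 𝕏, F q * (urnMass θ R q.1)⁻¹
      - a q.1 * b q.2 * (stepDev θ ν R f q.1 - stepDev θ ν R f q.2)
      = a q.1 * b q.2 * ((urnMass θ R q.2 - urnMass θ R q.1)
        / (urnMass θ R q.1 + urnMass θ R q.2 - θ)
        * (stepDev θ ν R f q.1
          - stepDev θ ν R f q.2 * ((urnMass θ R q.1 - θ) / urnMass θ R q.1))) := fun q => by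
    have h1 := (hX.urnMass_pos q.1).ne'
    have h2 := (hθ.trans_le (theta_le_urnMass_add_sub (θ := θ) (R := R) q.1 q.2)).ne'
    have e1 : stepOp θ ν R f q.1 = stepDev θ ν R f q.1 + c := by simp [stepDev, hc]
    have e2 : stepOp θ ν R f q.2 = stepDev θ ν R f q.2 + c := by simp [stepDev, hc]
    simp only [hFdef, e1, e2]
    field_simp
    ring
  have hN : ∀ q : 𝕏 × 𝕏, 0 < urnMass θ R q.1 + urnMass θ R q.2 - θ := fun q =>
    hθ.trans_le (theta_le_urnMass_add_sub (θ := θ) (R := R) q.1 q.2)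
  have hW0 : ∀ q : 𝕏 × 𝕏, 0 ≤ F q * (urnMass θ R q.1)⁻¹
      - a q.1 * b q.2 * (stepDev θ ν R f q.1 - stepDev θ ν R f q.2) := fun q => by
    rw [hdiff]
    by_cases h1 : a q.1 = 0
    · simp [h1]
    by_cases h2 : b q.2 = 0
    · simp [h2]
    obtain ⟨k1, k2, k3, k4⟩ := hab _ _ h1 h2
    have k5 : 0 ≤ (urnMass θ R q.1 - θ) / urnMass θ R q.1 :=
      div_nonneg (sub_nonneg.2 k1.le) (hX.urnMass_pos _).le
    refine mul_nonneg (mul_nonneg (ha0 _) (hb0 _)) (mul_nonneg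
      (div_nonneg (sub_nonneg.2 k2.le) (hN q).le) ?_)
    have := mul_nonneg (neg_nonneg.2 k4) k5
    linarith
  have hF0 : ∀ q, 0 ≤ F q := fun q => by
    have h := hW0 q
    have hd : 0 ≤ a q.1 * b q.2 * (stepDev θ ν R f q.1 - stepDev θ ν R f q.2) := by
      by_cases h1 : a q.1 = 0
      · simp [h1]
      by_cases h2 : b q.2 = 0
      · simp [h2]
      obtain ⟨k1, k2, k3, k4⟩ := hab _ _ h1 h2
      exact mul_nonneg (mul_nonneg (ha0 _) (hb0 _)) (by linarith)
    exact nonneg_of_mul_nonneg_left (by linarith) (inv_pos.2 (hX.urnMass_pos q.1))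
  have hG : BddMeas fun q : 𝕏 × 𝕏 => F q * (urnMass θ R q.1)⁻¹ :=
    hF.mul (hinv.comp measurable_fst)
  have hdev := hX.bddMeas_stepDev hf
  have d1 := ((ha.mul hdev).comp measurable_fst).mul (hb.comp (measurable_snd (α := 𝕏)))
  have d2 := (ha.comp measurable_fst).mul ((hb.mul hdev).comp (measurable_snd (α := 𝕏)))
  have hD : BddMeas fun q : 𝕏 × 𝕏 =>
      a q.1 * b q.2 * (stepDev θ ν R f q.1 - stepDev θ ν R f q.2) := by
    convert d1.sub d2 using 1
    funext q
    ring
  have hDint : ∫ q : 𝕏 × 𝕏, a q.1 * b q.2 * (stepDev θ ν R f q.1 - stepDev θ ν R f q.2) ∂ν.prod ν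
      = (∫ x, a x * stepOp θ ν R f x ∂ν) * (∫ x, b x ∂ν)
      - (∫ x, b x * stepOp θ ν R f x ∂ν) * ∫ x, a x ∂ν := by
    have e : ∀ q : 𝕏 × 𝕏, a q.1 * b q.2 * (stepDev θ ν R f q.1 - stepDev θ ν R f q.2)
        = (a q.1 * stepOp θ ν R f q.1) * b q.2 - a q.1 * (b q.2 * stepOp θ ν R f q.2) := fun q => by
      simp only [stepDev]
      ring
    simp only [e]
    rw [(((ha.mul hPf).comp measurable_fst).mul (hb.comp measurable_snd)).integral_sub
      ((ha.comp measurable_fst).mul ((hb.mul hPf).comp measurable_snd)),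
      integral_prod_mul (fun x => a x * stepOp θ ν R f x) b,
      integral_prod_mul a (fun x => b x * stepOp θ ν R f x)]
    ring
  have hFint : θ * ∫ q, F q * (urnMass θ R q.1)⁻¹ ∂ν.prod ν ≤ ∫ ω, F (X 0 ω, X 1 ω) ∂P := by
    rw [hX.integral_one hF, integral_prod _ (hG.integrable _), ← integral_const_mul]
    have hFx : ∀ x, BddMeas fun y => F (x, y) := fun x => hF.comp measurable_prodMk_left
    refine integral_mono ?_ ?_ fun x => ?_
    · exact ((hG.integrable (ν.prod ν)).integral_prod_left).const_mul θ
    · obtain ⟨C, hC⟩ := hF.bdd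
      refine Integrable.of_bound (StronglyMeasurable.integral_kernel_prod_right'
        (κ := stepKernel θ ν R) hF.meas.stronglyMeasurable).aestronglyMeasurable C
        (ae_of_all _ fun x => ?_)
      simpa using norm_integral_le_of_norm_le_const (μ := stepKernel θ ν R x)
        (ae_of_all _ fun y => (Real.norm_eq_abs (F (x, y))).le.trans (hC _))
    · have h := hX.theta_mul_integral_le x (hFx x) fun y => hF0 _
      simp only [integral_mul_const]
      have e : θ * ((∫ y, F (x, y) ∂ν) * (urnMass θ R x)⁻¹)
          = θ / urnMass θ R x * ∫ y, F (x, y) ∂ν := by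
        rw [div_eq_mul_inv]
        ring
      exact e.trans_le h
  have hle : ∫ q, F q * (urnMass θ R q.1)⁻¹
      - a q.1 * b q.2 * (stepDev θ ν R f q.1 - stepDev θ ν R f q.2) ∂ν.prod ν ≤ 0 := by
    rw [hG.integral_sub hD, hDint, sub_nonpos]
    exact le_of_mul_le_mul_left (hFint.trans hid.le) hθ
  have hzero := (integral_eq_zero_iff_of_nonneg hW0 ((hG.sub hD).integrable (ν.prod ν))).1
    (le_antisymm hle (integral_nonneg hW0))
  filter_upwards [hzero] with q hq h1 h2
  obtain ⟨k1, k2, k3, k4⟩ := hab _ _ h1 h2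
  simp only [hdiff, Pi.zero_apply] at hq
  have k6 : 0 < (urnMass θ R q.1 - θ) / urnMass θ R q.1 :=
    div_pos (sub_pos.2 k1) (hX.urnMass_pos _)
  have k7 := (div_pos (sub_pos.2 k2) (hN q)).ne'
  have hq' := (mul_eq_zero.1 ((mul_eq_zero.1 hq).resolve_left (mul_ne_zero h1 h2))).resolve_left k7
  have k8 : stepDev θ ν R f q.2 * ((urnMass θ R q.1 - θ) / urnMass θ R q.1) ≤ 0 :=
    mul_nonpos_of_nonpos_of_nonneg k4 k6.le
  have k9 : stepDev θ ν R f q.2 * ((urnMass θ R q.1 - θ) / urnMass θ R q.1) = 0 := by linarith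
  exact ⟨by linarith, (mul_eq_zero.1 k9).resolve_right k6.ne'⟩

/-- The deviation from `ν` cannot have opposite signs on a set of light colours and a set of heavy
colours. -/
lemma stepDev_trichotomy (hX : IsMVPS P X θ ν R) (hE : IsExchangeable P X)
    {f : 𝕏 → ℝ} (hf : BddMeas f) (hlf : BddMeas fun x => urnMass θ R x * f x) (c : ℝ) :
    (∀ᵐ x ∂ν, θ < urnMass θ R x → urnMass θ R x ≤ c → stepDev θ ν R f x < 0) ∨
    (∀ᵐ x ∂ν, θ < urnMass θ R x → c < urnMass θ R x → 0 < stepDev θ ν R f x) ∨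
    ((∀ᵐ x ∂ν, θ < urnMass θ R x → urnMass θ R x ≤ c → stepDev θ ν R f x ≤ 0) ∧
      ∀ᵐ x ∂ν, θ < urnMass θ R x → c < urnMass θ R x → 0 ≤ stepDev θ ν R f x) := by
  have := hX.isProbabilityMeasure
  have hθ := hX.theta_pos
  have hl : Measurable (urnMass θ R) := measurable_urnMass
  have hd := (hX.bddMeas_stepDev hf).meas
  set A : Set 𝕏 := {x | (θ < urnMass θ R x ∧ urnMass θ R x ≤ c) ∧ 0 ≤ stepDev θ ν R f x} with hAdef
  set B : Set 𝕏 := {x | (θ < urnMass θ R x ∧ c < urnMass θ R x) ∧ stepDev θ ν R f x ≤ 0} with hBdef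
  have hA : MeasurableSet A :=
    ((measurableSet_lt measurable_const hl).inter (measurableSet_le hl measurable_const)).inter
      (measurableSet_le measurable_const hd)
  have hB : MeasurableSet B :=
    ((measurableSet_lt measurable_const hl).inter (measurableSet_lt measurable_const hl)).inter
      (measurableSet_le hd measurable_const)
  have hpos : ∀ x, 0 < urnMass θ R x := hX.urnMass_pos
  -- On A the mass is at most c, but on B it may be unbounded. Dividing the indicator of B by ℓ
  -- makes ℓ·b bounded.
  have key := hX.ae_stepDev_eq_zero_of_mul_ne_zero hE hf hlf (a := A.indicator fun _ => 1)
    (b := fun x => B.indicator (fun _ => 1) x * (urnMass θ R x)⁻¹) (BddMeas.indicator_one hA)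
    (by
      refine BddMeas.of_le (C := |c|) (hl.mul (measurable_const.indicator hA)) fun x => ?_
      by_cases hx : x ∈ A
      · rw [Set.indicator_of_mem hx, mul_one, abs_of_pos (hpos x)]
        exact hx.1.2.trans (le_abs_self c)
      · simp [hx])
    (by
      refine BddMeas.of_le (C := θ⁻¹) ((measurable_const.indicator hB).mul hl.inv) fun x => ?_
      by_cases hx : x ∈ B
      · rw [Set.indicator_of_mem hx, one_mul, abs_of_pos (inv_pos.2 (hpos x))]
        exact inv_anti₀ hθ hx.1.1.le
      · simp [hx, hθ.le])
    (by
      have := BddMeas.indicator_one hB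
      convert this using 1
      funext x
      have := (hpos x).ne'
      field_simp)
    (fun x => Set.indicator_nonneg (fun _ _ => zero_le_one) x)
    (fun x => mul_nonneg (Set.indicator_nonneg (fun _ _ => zero_le_one) x) (inv_pos.2 (hpos x)).le)
    (fun x y hx hy => by
      have hx' : x ∈ A := by
        by_contra h
        simp [h] at hx
      have hy' : y ∈ B := by
        by_contra h
        simp [h] at hy
      exact ⟨hx'.1.1, hx'.1.2.trans_lt hy'.1.2, hx'.2, hy'.2⟩)
  have key' : ∀ᵐ q ∂ν.prod ν, q.1 ∈ A → q.2 ∈ B →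
      stepDev θ ν R f q.1 = 0 ∧ stepDev θ ν R f q.2 = 0 := by
    filter_upwards [key] with q hq h1 h2
    exact hq (by simp [h1]) (by simp [h2, (hpos q.2).ne'])
  have hAB := Measure.ae_ae_of_ae_prod key'
  -- If A or B is null, one of the strict alternatives holds. If both are non-null, D f vanishes
  -- a.e. on each of them, which gives the two weak inequalities.
  by_cases hA0 : ∀ᵐ x ∂ν, x ∉ A
  · left
    filter_upwards [hA0] with x hx h1 h2
    by_contra h
    exact hx ⟨⟨h1, h2⟩, not_lt.1 h⟩
  right
  by_cases hB0 : ∀ᵐ x ∂ν, x ∉ B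
  · left
    filter_upwards [hB0] with x hx h1 h2
    by_contra h
    exact hx ⟨⟨h1, h2⟩, not_lt.1 h⟩
  right
  constructor
  · filter_upwards [hAB] with x hx h1 h2
    by_contra! h
    have hxA : x ∈ A := ⟨⟨h1, h2⟩, h.le⟩
    refine hB0 ?_
    filter_upwards [hx] with y hy hyB
    exact h.ne' (hy hxA hyB).1
  · obtain ⟨x, hxA, hx⟩ : ∃ x ∈ A, ∀ᵐ y ∂ν, x ∈ A → y ∈ B →
        stepDev θ ν R f x = 0 ∧ stepDev θ ν R f y = 0 := by
      by_contra h
      refine hA0 ?_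
      filter_upwards [hAB] with x hx hxA
      exact h ⟨x, hxA, hx⟩
    filter_upwards [hx] with y hy h1 h2
    by_contra! h
    exact h.ne (hy hxA ⟨⟨h1, h2⟩, h.le⟩).2

end IsMVPS

end Dichotomy

/-! ### Balanced reinforcement, or reinforcement proportional to ν -/

section PredictiveDichotomy

variable {Ω 𝕏 : Type*} [mΩ : MeasurableSpace Ω] [m𝕏 : MeasurableSpace 𝕏]

namespace IsMVPS

variable {P : Measure Ω} {X : ℕ → Ω → 𝕏} {θ : ℝ} {ν : Measure 𝕏}
  {R : Kernel 𝕏 𝕏}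

lemma theta_le_urnMass (x : 𝕏) : θ ≤ urnMass θ R x := le_add_of_nonneg_right measureReal_nonneg

lemma mem_nullPart_iff (hX : IsMVPS P X θ ν R) (x : 𝕏) : x ∈ nullPart R ↔ urnMass θ R x = θ := by
  rw [nullPart, Set.mem_ofPred_eq, urnMass, add_eq_left, measureReal_def, ENNReal.toReal_eq_zero_iff]
  simp [(hX.finite_kernel x).ne]

lemma theta_lt_urnMass_iff (hX : IsMVPS P X θ ν R) (x : 𝕏) :
    θ < urnMass θ R x ↔ x ∈ (nullPart R)ᶜ := by
  rw [Set.mem_compl_iff, hX.mem_nullPart_iff, lt_iff_le_and_ne, ne_comm]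
  simp [theta_le_urnMass]

lemma stepDev_eq_zero_of_mem_nullPart (hX : IsMVPS P X θ ν R) {f : 𝕏 → ℝ} (hf : BddMeas f) {x : 𝕏}
    (hx : x ∈ nullPart R) : stepDev θ ν R f x = 0 := by
  have h := hX.integral_stepKernel x hf
  have h0 : R x = 0 := Measure.measure_univ_eq_zero.1 hx
  rw [(hX.mem_nullPart_iff x).1 hx, h0, integral_zero_measure, add_zero] at h
  rw [stepDev, stepOp, mul_left_cancel₀ hX.theta_pos.ne' h, sub_self]

variable [IsProbabilityMeasure P]

lemma integral_mul_stepDev (hX : IsMVPS P X θ ν R) (hE : IsExchangeable P X) {f g : 𝕏 → ℝ}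
    (hf : BddMeas f) (hg : BddMeas g) :
    ∫ x, g x * stepDev θ ν R f x ∂ν = ∫ x, f x * stepDev θ ν R g x ∂ν := by
  have := hX.isProbabilityMeasure
  have h := hX.stepOp_symm hE hf hg
  simp only [stepDev, mul_sub]
  rw [(hg.mul (hX.bddMeas_stepOp hf)).integral_sub (hg.mul (.const _)),
    (hf.mul (hX.bddMeas_stepOp hg)).integral_sub (hf.mul (.const _)), integral_mul_const,
    integral_mul_const, h]
  ring

lemma integral_stepDev (hX : IsMVPS P X θ ν R) (hE : IsExchangeable P X) {f : 𝕏 → ℝ}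
    (hf : BddMeas f) : ∫ x, stepDev θ ν R f x ∂ν = 0 := by
  have := hX.isProbabilityMeasure
  have := hX.isMarkovKernel_stepKernel
  have h := hX.integral_mul_stepDev hE hf (.const 1)
  simpa [stepDev, stepOp] using h

/-- Colours in the null part are drawn with their initial probabilities. -/
lemma ae_stepDev_eq_zero_of_support (hX : IsMVPS P X θ ν R) (hE : IsExchangeable P X) {f : 𝕏 → ℝ}
    (hf : BddMeas f) (hsupp : ∀ x, f x ≠ 0 → x ∈ nullPart R) :
    ∀ᵐ x ∂ν, stepDev θ ν R f x = 0 := by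
  have := hX.isProbabilityMeasure
  have hd := hX.bddMeas_stepDev hf
  -- Self-adjointness of D, tested on D f: ∫ (D f)² = ∫ f · D(D f), and D(D f) is zero on Z, where f
  -- lives.
  have h := hX.integral_mul_stepDev hE hf hd
  have h0 : ∀ x, f x * stepDev θ ν R (stepDev θ ν R f) x = 0 := fun x => by
    by_cases hx : f x = 0
    · rw [hx, zero_mul]
    · rw [hX.stepDev_eq_zero_of_mem_nullPart hd (hsupp x hx), mul_zero]
  simp only [h0, integral_const, smul_zero] at h
  have h1 := (integral_eq_zero_iff_of_nonneg (fun x => mul_self_nonneg _)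
    ((hd.mul hd).integrable ν)).1 h
  filter_upwards [h1] with x hx
  exact mul_self_eq_zero.1 hx

lemma ae_stepDev_eq_zero_of_nonpos (hX : IsMVPS P X θ ν R) (hE : IsExchangeable P X) {f : 𝕏 → ℝ}
    (hf : BddMeas f) (h : ∀ᵐ x ∂ν, stepDev θ ν R f x ≤ 0) :
    ∀ᵐ x ∂ν, stepDev θ ν R f x = 0 := by
  have := hX.isProbabilityMeasure
  have h0 := hX.integral_stepDev hE hf
  have h1 : ∫ x, - stepDev θ ν R f x ∂ν = 0 := by rw [integral_neg, h0, neg_zero]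
  have h2 : 0 ≤ᵐ[ν] fun x => - stepDev θ ν R f x := by
    filter_upwards [h] with x hx
    simpa using hx
  filter_upwards [(integral_eq_zero_iff_of_nonneg_ae h2
    ((hX.bddMeas_stepDev hf).neg.integrable ν)).1 h1] with x hx
  exact neg_eq_zero.1 hx

/-- Apply the trichotomy to f and to −f. Since light and heavy colours both have positive measure,
the compatible combinations give D f ≤ 0 a.e., D f ≥ 0 a.e., or D f = 0 a.e.; the first two reduce
to the third because D f has integral zero. -/
lemma ae_stepDev_eq_zero_of_unbalanced_of_mul (hX : IsMVPS P X θ ν R) (hE : IsExchangeable P X)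
    {f : 𝕏 → ℝ} (hf : BddMeas f) (hlf : BddMeas fun x => urnMass θ R x * f x) {c : ℝ}
    (hL : ¬ ∀ᵐ x ∂ν, ¬ (θ < urnMass θ R x ∧ urnMass θ R x ≤ c))
    (hH : ¬ ∀ᵐ x ∂ν, ¬ (θ < urnMass θ R x ∧ c < urnMass θ R x)) :
    ∀ᵐ x ∂ν, stepDev θ ν R f x = 0 := by
  have hlf' : BddMeas fun x => urnMass θ R x * - f x := by
    simpa only [mul_neg] using hlf.neg
  have hZ : ∀ x, ¬ θ < urnMass θ R x → stepDev θ ν R f x = 0 := fun x hx =>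
    hX.stepDev_eq_zero_of_mem_nullPart hf ((hX.mem_nullPart_iff x).2
      (le_antisymm (not_lt.1 hx) (theta_le_urnMass x)))
  have hZ' : ∀ x, ¬ θ < urnMass θ R x → stepDev θ ν R (fun y => - f y) x = 0 := fun x hx => by
    rw [stepDev_neg, hZ x hx, neg_zero]
  have hneg : (∀ᵐ x ∂ν, stepDev θ ν R (fun y => - f y) x ≤ 0) →
      ∀ᵐ x ∂ν, stepDev θ ν R f x = 0 := fun h => by
    filter_upwards [hX.ae_stepDev_eq_zero_of_nonpos hE hf.neg h] with x hx
    rwa [stepDev_neg, neg_eq_zero] at hx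
  have t1 := hX.stepDev_trichotomy hE hf hlf c
  have t2 := hX.stepDev_trichotomy hE hf.neg hlf' c
  simp only [stepDev_neg, Left.neg_neg_iff, Left.neg_pos_iff, Left.neg_nonpos_iff,
    Left.nonneg_neg_iff] at t2 hneg
  rcases t1 with t1 | t1 | ⟨t1, t1'⟩ <;> rcases t2 with t2 | t2 | ⟨t2, t2'⟩
  · refine absurd ?_ hL
    filter_upwards [t1, t2] with x h1 h2 h
    exact lt_asymm (h1 h.1 h.2) (h2 h.1 h.2)
  · refine hX.ae_stepDev_eq_zero_of_nonpos hE hf ?_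
    filter_upwards [t1, t2] with x h1 h2
    by_cases h : θ < urnMass θ R x
    · exact (le_or_gt (urnMass θ R x) c).elim (fun k => (h1 h k).le) (fun k => (h2 h k).le)
    · exact (hZ x h).le
  · refine absurd ?_ hL
    filter_upwards [t1, t2] with x h1 h2 h
    exact (h1 h.1 h.2).not_ge (h2 h.1 h.2)
  · refine hneg ?_
    filter_upwards [t1, t2] with x h1 h2
    by_cases h : θ < urnMass θ R x
    · exact (le_or_gt (urnMass θ R x) c).elim (fun k => (h2 h k).le) (fun k => (h1 h k).le)
    · exact (hZ x h).ge
  · refine absurd ?_ hH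
    filter_upwards [t1, t2] with x h1 h2 h
    exact lt_asymm (h1 h.1 h.2) (h2 h.1 h.2)
  · refine absurd ?_ hH
    filter_upwards [t1, t2'] with x h1 h2 h
    exact (h1 h.1 h.2).not_ge (h2 h.1 h.2)
  · refine absurd ?_ hL
    filter_upwards [t1, t2] with x h1 h2 h
    exact (h2 h.1 h.2).not_ge (h1 h.1 h.2)
  · refine absurd ?_ hH
    filter_upwards [t1', t2] with x h1 h2 h
    exact (h2 h.1 h.2).not_ge (h1 h.1 h.2)
  · filter_upwards [t1, t1', t2, t2'] with x h1 h1' h2 h2'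
    by_cases h : θ < urnMass θ R x
    · exact (le_or_gt (urnMass θ R x) c).elim (fun k => le_antisymm (h1 h k) (h2 h k))
        (fun k => le_antisymm (h2' h k) (h1' h k))
    · exact hZ x h

/-- Truncating f to {ℓ ≤ n} makes ℓ·f bounded; dominated convergence removes the truncation. -/
lemma ae_stepDev_eq_zero_of_unbalanced (hX : IsMVPS P X θ ν R) (hE : IsExchangeable P X)
    {f : 𝕏 → ℝ} (hf : BddMeas f) {c : ℝ}
    (hL : ¬ ∀ᵐ x ∂ν, ¬ (θ < urnMass θ R x ∧ urnMass θ R x ≤ c))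
    (hH : ¬ ∀ᵐ x ∂ν, ¬ (θ < urnMass θ R x ∧ c < urnMass θ R x)) :
    ∀ᵐ x ∂ν, stepDev θ ν R f x = 0 := by
  have := hX.isProbabilityMeasure
  have := hX.isMarkovKernel_stepKernel
  have hl : Measurable (urnMass θ R) := measurable_urnMass
  set S : ℕ → Set 𝕏 := fun n => {x | urnMass θ R x ≤ n} with hS
  have hSm : ∀ n, MeasurableSet (S n) := fun n => measurableSet_le hl measurable_const
  set g : ℕ → 𝕏 → ℝ := fun n x => f x * (S n).indicator (fun _ => 1) x with hg
  have hgb : ∀ n, BddMeas (g n) := fun n => hf.mul (BddMeas.indicator_one (hSm n))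
  obtain ⟨C, hC⟩ := hf.bdd
  have hgl : ∀ n, BddMeas fun x => urnMass θ R x * g n x := fun n => by
    refine BddMeas.of_le (C := n * C) (hl.mul (hgb n).meas) fun x => ?_
    have hC0 := (abs_nonneg _).trans (hC x)
    by_cases hx : x ∈ S n
    · rw [hg]
      simp only [Set.indicator_of_mem hx, mul_one, abs_mul, abs_of_pos (hX.urnMass_pos x)]
      exact mul_le_mul hx (hC x) (abs_nonneg _) n.cast_nonneg
    · simp only [hg, Set.indicator_of_notMem hx, mul_zero, abs_zero]
      positivity
  have h := ae_all_iff.2 fun n =>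
    hX.ae_stepDev_eq_zero_of_unbalanced_of_mul hE (hgb n) (hgl n) hL hH
  have hlim : ∀ y, Filter.Tendsto (fun n => g n y) Filter.atTop (nhds (f y)) := fun y => by
    obtain ⟨N, hN⟩ := exists_nat_ge (urnMass θ R y)
    refine tendsto_const_nhds.congr' ?_
    filter_upwards [Filter.eventually_ge_atTop N] with n hn
    have hy : y ∈ S n := hN.trans (by exact_mod_cast hn)
    simp [hg, hy]
  have hint : ∀ (μ : Measure 𝕏) [IsFiniteMeasure μ],
      Filter.Tendsto (fun n => ∫ y, g n y ∂μ) Filter.atTop (nhds (∫ y, f y ∂μ)) := fun μ _ => by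
    refine tendsto_integral_of_dominated_convergence (fun _ => C)
      (fun n => (hgb n).meas.aestronglyMeasurable) (integrable_const C)
      (fun n => ae_of_all _ fun y => ?_) (ae_of_all _ hlim)
    rw [Real.norm_eq_abs, hg]
    by_cases hy : y ∈ S n
    · simpa [hy] using hC y
    · simpa [hy] using (abs_nonneg _).trans (hC y)
  filter_upwards [h] with x hx
  refine tendsto_nhds_unique ((hint (stepKernel θ ν R x)).sub (hint ν)) ?_
  exact tendsto_const_nhds.congr fun n => (hx n).symm

/-- An exchangeable sequence is balanced off the null part, or its observations are pairwise
independent. -/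
lemma balanced_or_stepDev_eq_zero (hX : IsMVPS P X θ ν R) (hE : IsExchangeable P X)
    (hZ : ν (nullPart R)ᶜ ≠ 0) :
    (∃ m : ℝ, 0 < m ∧ ∀ᵐ x ∂ν, x ∈ (nullPart R)ᶜ → urnMass θ R x = θ + m) ∨
    ∀ f : 𝕏 → ℝ, BddMeas f → ∀ᵐ x ∂ν, stepDev θ ν R f x = 0 := by
  by_cases hc : ∃ c : ℚ, (¬ ∀ᵐ x ∂ν, ¬ (θ < urnMass θ R x ∧ urnMass θ R x ≤ c)) ∧
      ¬ ∀ᵐ x ∂ν, ¬ (θ < urnMass θ R x ∧ c < urnMass θ R x)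
  · obtain ⟨c, hL, hH⟩ := hc
    exact Or.inr fun f hf => hX.ae_stepDev_eq_zero_of_unbalanced hE hf hL hH
  left
  -- Almost every colour avoids, simultaneously for all rational thresholds c, whichever of the
  -- light and heavy sets at c is null. Two such colours off Z must have the same mass.
  have hgood : ∀ᵐ x ∂ν, ∀ c : ℚ,
      ((∀ᵐ x ∂ν, ¬ (θ < urnMass θ R x ∧ urnMass θ R x ≤ c)) →
        ¬ (θ < urnMass θ R x ∧ urnMass θ R x ≤ c)) ∧
      ((∀ᵐ x ∂ν, ¬ (θ < urnMass θ R x ∧ c < urnMass θ R x)) →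
        ¬ (θ < urnMass θ R x ∧ c < urnMass θ R x)) := by
    refine ae_all_iff.2 fun c => Filter.Eventually.and ?_ ?_
    · by_cases h : ∀ᵐ x ∂ν, ¬ (θ < urnMass θ R x ∧ urnMass θ R x ≤ c)
      · filter_upwards [h] with x hx _ using hx
      · exact ae_of_all _ fun x hx => absurd hx h
    · by_cases h : ∀ᵐ x ∂ν, ¬ (θ < urnMass θ R x ∧ c < urnMass θ R x)
      · filter_upwards [h] with x hx _ using hx
      · exact ae_of_all _ fun x hx => absurd hx h
  obtain ⟨x, hxZ, hx⟩ : ∃ x ∈ (nullPart R)ᶜ, ∀ c : ℚ,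
      ((∀ᵐ x ∂ν, ¬ (θ < urnMass θ R x ∧ urnMass θ R x ≤ c)) →
        ¬ (θ < urnMass θ R x ∧ urnMass θ R x ≤ c)) ∧
      ((∀ᵐ x ∂ν, ¬ (θ < urnMass θ R x ∧ c < urnMass θ R x)) →
        ¬ (θ < urnMass θ R x ∧ c < urnMass θ R x)) := by
    by_contra h
    refine hZ ?_
    rw [measure_eq_zero_iff_ae_notMem]
    filter_upwards [hgood] with x hx hxZ
    exact h ⟨x, hxZ, hx⟩
  have hx0 := (hX.theta_lt_urnMass_iff x).2 hxZ
  refine ⟨urnMass θ R x - θ, sub_pos.2 hx0, ?_⟩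
  filter_upwards [hgood] with y hy hyZ
  have hy0 := (hX.theta_lt_urnMass_iff y).2 hyZ
  rw [add_sub_cancel]
  -- a rational number strictly between two different masses gives a contradiction
  have key : ∀ x y : 𝕏, θ < urnMass θ R x → θ < urnMass θ R y →
      (∀ c : ℚ, (∀ᵐ x ∂ν, ¬ (θ < urnMass θ R x ∧ urnMass θ R x ≤ c)) →
        ¬ (θ < urnMass θ R x ∧ urnMass θ R x ≤ c)) →
      (∀ c : ℚ, (∀ᵐ x ∂ν, ¬ (θ < urnMass θ R x ∧ c < urnMass θ R x)) →
        ¬ (θ < urnMass θ R y ∧ c < urnMass θ R y)) → urnMass θ R y ≤ urnMass θ R x := by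
    intro x y hx0 hy0 hx hy
    by_contra! hlt
    obtain ⟨c, hc1, hc2⟩ := exists_rat_btwn hlt
    by_cases h : ∀ᵐ x ∂ν, ¬ (θ < urnMass θ R x ∧ urnMass θ R x ≤ c)
    · exact hx c h ⟨hx0, hc1.le⟩
    · exact hy c (by_contra fun h' => hc ⟨c, h, h'⟩) ⟨hy0, hc2⟩
  exact le_antisymm (key x y hx0 hy0 (fun c => (hx c).1) fun c => (hy c).2)
    (key y x hy0 hx0 (fun c => (hy c).1) fun c => (hx c).2)

end IsMVPS

end PredictiveDichotomy

/-! ### Invariant kernels as conditional distributions -/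

section InvariantKernel

variable {𝕏 : Type*}

/-- Two finite kernels agree almost everywhere if they do so on each measurable set. -/
lemma kernel_ae_eq_of_forall {m0 : MeasurableSpace 𝕏}
    {m𝕏 : MeasurableSpace 𝕏} [StandardBorelSpace 𝕏] {μ : @Measure 𝕏 m0} [IsFiniteMeasure μ] 
    {κ η : @Kernel 𝕏 𝕏 m0 m𝕏}
    [IsFiniteKernel κ] [IsFiniteKernel η]
    (h : ∀ B, MeasurableSet[m𝕏] B → ∀ᵐ x ∂μ, κ x B = η x B) : ∀ᵐ x ∂μ, κ x = η x := by
  refine Kernel.ae_eq_of_compProd_eq (Measure.ext_prod fun {S B} hS hB => ?_)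
  rw [Measure.compProd_apply_prod hS hB, Measure.compProd_apply_prod hS hB]
  exact lintegral_congr_ae (ae_restrict_of_ae (h B hB))

/-- Characterization of the conditional distribution of `ν` given `G`. -/
lemma ae_eq_condExpKernel {G : MeasurableSpace 𝕏} {m𝕏 : MeasurableSpace 𝕏} [StandardBorelSpace 𝕏]
    {ν : Measure 𝕏} [IsFiniteMeasure ν] (hG : G ≤ m𝕏) {κ : Kernel 𝕏 𝕏} [hfin : IsFiniteKernel κ]
    (hκG : ∀ B, MeasurableSet B → Measurable[G] fun x => κ x B)
    (hset : ∀ A, MeasurableSet[G] A → ∀ B, MeasurableSet B → ∫⁻ x in A, κ x B ∂ν = ν (A ∩ B)) :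
    ∀ᵐ x ∂ν, κ x = condExpKernel ν G x := by
  let κG : @Kernel 𝕏 𝕏 G m𝕏 := @Kernel.mk 𝕏 𝕏 G m𝕏 (fun x => κ x)
    (@Measure.measurable_of_measurable_coe 𝕏 𝕏 m𝕏 G _ hκG)
  have : @IsFiniteKernel 𝕏 𝕏 G m𝕏 κG := by
    obtain ⟨C, hCtop, hC⟩ := hfin
    exact ⟨C, hCtop, hC⟩
  have hprod : ∀ᵐ x ∂ν.trim hG, κG x = condExpKernel ν G x := by
    refine Kernel.ae_eq_of_compProd_eq ?_
    rw [compProd_trim_condExpKernel hG]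
    refine Measure.ext_prod fun {A B} hA hB => ?_
    have hdiag : @Measurable 𝕏 (𝕏 × 𝕏) m𝕏 (G.prod m𝕏) Function.diag :=
      (measurable_id'' hG).prodMk measurable_id
    rw [Measure.compProd_apply_prod hA hB, Measure.map_apply hdiag (hA.prod hB),
      restrict_trim hG ν hA]
    exact (lintegral_trim hG (hκG B hB)).trans (hset A hA B hB)
  exact ae_of_ae_trim hG hprod

/-- A kernel that is invariant under itself and leaves `ν` invariant is the conditional
distribution of `ν` given a countably generated σ-algebra. -/
lemma exists_condExpKernel_eq [m𝕏 : MeasurableSpace 𝕏] [StandardBorelSpace 𝕏] (ν : Measure 𝕏)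
    [IsProbabilityMeasure ν] (κ : Kernel 𝕏 𝕏) [IsFiniteKernel κ] {W : Set 𝕏}
    (hW : MeasurableSet W)
    (hinv : ∀ B, MeasurableSet B → ∫⁻ x, κ x B ∂ν = ν B)
    (hκW : ∀ᵐ x ∂ν, ∀ᵐ y ∂κ x, (y ∈ W ↔ x ∈ W))
    (hκ : ∀ B, MeasurableSet B → ∀ᵐ x ∂ν, ∀ᵐ y ∂κ x, κ y B = κ x B) :
    ∃ G : MeasurableSpace 𝕏, G ≤ m𝕏 ∧ CGUnder G ν ∧ MeasurableSet[G] W ∧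
      ∀ᵐ x ∂ν, κ x = @condExpKernel 𝕏 m𝕏 _ ν _ G x := by
  set 𝒜 : Set (Set 𝕏) := generateSetAlgebra (MeasurableSpace.countableGeneratingSet 𝕏) with h𝒜
  have h𝒜c : 𝒜.Countable :=
    countable_generateSetAlgebra (MeasurableSpace.countable_countableGeneratingSet)
  have h𝒜g : m𝕏 = MeasurableSpace.generateFrom 𝒜 := by
    rw [h𝒜, generateFrom_generateSetAlgebra_eq,
      MeasurableSpace.generateFrom_countableGeneratingSet]
  have h𝒜a : IsSetAlgebra 𝒜 := isSetAlgebra_generateSetAlgebra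
  have h𝒜m : ∀ A ∈ 𝒜, MeasurableSet A := fun A hA => by
    rw [h𝒜g]
    exact MeasurableSpace.measurableSet_generateFrom hA
  have := h𝒜c.to_subtype
  -- φ records κ_x on a countable generating algebra, together with the side of W on which x lies; G
  -- is the σ-algebra generated by φ. By `hκW`, including the indicator of W keeps φ constant
  -- κ_x-a.s.
  set φ : 𝕏 → (𝒜 → ℝ≥0∞) × ℝ≥0∞ := fun x => (fun A : 𝒜 => κ x A, W.indicator (fun _ => 1) x) with hφ
  have hφm : Measurable φ := (measurable_pi_lambda _ fun A : 𝒜 => κ.measurable_coe (h𝒜m (A : Set 𝕏) A.2)).prodMk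
    (measurable_const.indicator hW)
  have hφG : Measurable[MeasurableSpace.comap φ inferInstance] φ := comap_measurable φ
  have hκG : Measurable[MeasurableSpace.comap φ inferInstance] (fun x => κ x) := by
    refine @Measurable.measure_of_isPiSystem _ _ (MeasurableSpace.comap φ inferInstance) m𝕏
      (fun x => κ x) _ 𝒜 h𝒜g (fun A hA B hB _ => h𝒜a.inter_mem hA hB) (fun A hA => ?_) ?_
    · exact (measurable_pi_apply (⟨A, hA⟩ : 𝒜)).comp (measurable_fst.comp hφG)
    · exact (measurable_pi_apply (⟨Set.univ, h𝒜a.univ_mem⟩ : 𝒜)).comp (measurable_fst.comp hφG)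
  have hWG : MeasurableSet[MeasurableSpace.comap φ inferInstance] W := by
    have : W = (fun x => (φ x).2) ⁻¹' {1} := by
      ext x
      by_cases hx : x ∈ W <;> simp [hφ, hx]
    rw [this]
    exact (measurable_snd.comp hφG) (measurableSet_singleton 1)
  have hφκ : ∀ᵐ x ∂ν, ∀ᵐ y ∂κ x, φ y = φ x := by
    have h1 : ∀ᵐ x ∂ν, ∀ A : 𝒜, ∀ᵐ y ∂κ x, κ y A = κ x A :=
      ae_all_iff.2 fun A => hκ A (h𝒜m A A.2)
    filter_upwards [h1, hκW] with x hx hx'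
    filter_upwards [ae_all_iff.2 hx, hx'] with y hy hy'
    refine Prod.ext (funext hy) ?_
    by_cases h : x ∈ W
    · simp [hφ, h, hy'.2 h]
    · simp [hφ, h, mt hy'.1 h]
  -- As φ is κ_x-a.s. equal to φ(x), κ_x(A ∩ B) is κ_x(B) if x ∈ A and 0 otherwise, for A ∈ G.
  -- Integrating and using that κ preserves ν gives the defining property of ν(· | G).
  have hset : ∀ A, MeasurableSet[MeasurableSpace.comap φ inferInstance] A → ∀ B, MeasurableSet B →
      ∫⁻ x in A, κ x B ∂ν = ν (A ∩ B) := by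
    rintro A hA B hB
    obtain ⟨S, hS, rfl⟩ := hA
    have hAm : MeasurableSet (φ ⁻¹' S) := hφm hS
    rw [← hinv _ (hAm.inter hB), ← lintegral_indicator hAm]
    refine lintegral_congr_ae ?_
    filter_upwards [hφκ] with x hx
    by_cases h : φ x ∈ S
    · rw [Set.indicator_of_mem (by exact h)]
      refine measure_congr ?_
      filter_upwards [hx] with y hy
      refine propext ⟨fun hyB => ⟨?_, hyB⟩, fun hyB => hyB.2⟩
      change φ y ∈ S
      rwa [hy]
    · rw [Set.indicator_of_notMem (by exact h)]
      refine (measure_eq_zero_iff_ae_notMem.2 ?_).symm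
      filter_upwards [hx] with y hy hyS
      refine h ?_
      rw [← hy]
      exact hyS.1
  refine ⟨MeasurableSpace.comap φ inferInstance, hφm.comap_le,
    ⟨Set.univ, MeasurableSet.univ, measure_univ, ?_⟩, hWG,
    ae_eq_condExpKernel hφm.comap_le (fun B hB => (Measure.measurable_coe hB).comp hκG) hset⟩
  have h : @MeasurableSpace.CountablyGenerated 𝕏 (MeasurableSpace.comap φ inferInstance) :=
    MeasurableSpace.CountablyGenerated.comap φ
  exact @MeasurableSpace.CountablyGenerated.comap _ 𝕏 (MeasurableSpace.comap φ inferInstance) h _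

end InvariantKernel

/-! ### The balanced case: reinforcement as a projection -/

section Balanced

variable {Ω 𝕏 : Type*} [mΩ : MeasurableSpace Ω] [m𝕏 : MeasurableSpace 𝕏]

namespace IsMVPS

variable {P : Measure Ω} {X : ℕ → Ω → 𝕏} {θ : ℝ} {ν : Measure 𝕏}
  {R : Kernel 𝕏 𝕏}

lemma absolutelyContinuous_stepKernel (hX : IsMVPS P X θ ν R) (x : 𝕏) :
    R x ≪ stepKernel θ ν R x := by
  have e : stepKernel θ ν R x = (urnMeasure θ ν R (fun _ : Fin 1 => x) Set.univ)⁻¹ •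
      (ENNReal.ofReal θ • ν + R x) := by
    rw [stepKernel, Kernel.comap_apply, urnKernel_apply]
    simp [urnMeasure]
  rw [e]
  refine Measure.AbsolutelyContinuous.smul_right ?_
    (ENNReal.inv_ne_zero.2 (hX.urnMeasure_univ_ne_top _))
  exact Measure.absolutelyContinuous_of_le (Measure.le_add_left le_rfl)

lemma kernel_real_eq (hX : IsMVPS P X θ ν R) (x : 𝕏) {A : Set 𝕏} (hA : MeasurableSet A) :
    (R x).real A = (urnMass θ R x - θ) * ν.real A
      + urnMass θ R x * stepDev θ ν R (A.indicator fun _ => 1) x := by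
  have h := hX.integral_stepKernel x (BddMeas.indicator_one hA)
  have e1 : ∫ y, A.indicator (fun _ => (1 : ℝ)) y ∂ν = ν.real A := integral_indicator_one hA
  have e2 : ∫ y, A.indicator (fun _ => (1 : ℝ)) y ∂(R x) = (R x).real A := integral_indicator_one hA
  rw [stepDev, stepOp, mul_sub, h, e1, e2]
  ring

variable [IsProbabilityMeasure P]

lemma integral_stepOp (hX : IsMVPS P X θ ν R) (hE : IsExchangeable P X) {f : 𝕏 → ℝ}
    (hf : BddMeas f) : ∫ x, stepOp θ ν R f x ∂ν = ∫ x, f x ∂ν := by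
  have := hX.isProbabilityMeasure
  have h := hX.integral_stepDev hE hf
  simp only [stepDev] at h
  rw [(hX.bddMeas_stepOp hf).integral_sub (.const _)] at h
  simpa [sub_eq_zero] using h

/-- K preserves ν, by reversibility, so a ν-null set is null for the one-step kernel from ν-a.e.
colour. -/
lemma ae_ae_stepKernel (hX : IsMVPS P X θ ν R) (hE : IsExchangeable P X) {q : 𝕏 → Prop}
    (hq : ∀ᵐ y ∂ν, q y) : ∀ᵐ x ∂ν, ∀ᵐ y ∂stepKernel θ ν R x, q y := by
  have := hX.isProbabilityMeasure
  have := hX.isMarkovKernel_stepKernel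
  obtain ⟨N, hN, hNm, hN0⟩ := exists_measurable_superset_of_null hq
  have h := hX.integral_stepOp hE (BddMeas.indicator_one hNm)
  have e1 : ∫ y, N.indicator (fun _ => (1 : ℝ)) y ∂ν = 0 := by
    rw [show ∫ y, N.indicator (fun _ => (1 : ℝ)) y ∂ν = ν.real N from integral_indicator_one hNm,
      measureReal_def, hN0, ENNReal.toReal_zero]
  rw [e1, integral_eq_zero_iff_of_nonneg] at h
  · filter_upwards [h] with x hx
    refine measure_mono_null hN ?_
    have e2 : stepOp θ ν R (N.indicator fun _ => 1) x = (stepKernel θ ν R x).real N :=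
      integral_indicator_one hNm
    rw [e2, Pi.zero_apply, measureReal_eq_zero_iff] at hx
    exact hx
  · exact fun x => integral_nonneg fun y => Set.indicator_nonneg (fun _ _ => zero_le_one) y
  · exact (hX.bddMeas_stepOp (BddMeas.indicator_one hNm)).integrable ν

lemma stepOp_congr (hX : IsMVPS P X θ ν R) (hE : IsExchangeable P X) {f g : 𝕏 → ℝ}
    (h : f =ᵐ[ν] g) : stepOp θ ν R f =ᵐ[ν] stepOp θ ν R g := by
  filter_upwards [hX.ae_ae_stepKernel hE h] with x hx
  exact integral_congr_ae hx

/-- The total probability of the colours off the null part is not affected by the observations. -/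
lemma ae_stepOp_indicator_compl (hX : IsMVPS P X θ ν R) (hE : IsExchangeable P X) :
    ∀ᵐ x ∂ν, stepOp θ ν R ((nullPart R)ᶜ.indicator fun _ => 1) x = ν.real (nullPart R)ᶜ := by
  have := hX.isProbabilityMeasure
  have := hX.isMarkovKernel_stepKernel
  have hm : MeasurableSet (nullPart R) := measurableSet_nullPart
  have h := hX.ae_stepDev_eq_zero_of_support hE (BddMeas.indicator_one hm) fun x hx => by
    by_contra h
    simp [h] at hx
  filter_upwards [h] with x hx
  have e1 : ∫ y, (nullPart R).indicator (fun _ => (1 : ℝ)) y ∂ν = ν.real (nullPart R) :=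
    integral_indicator_one hm
  have e2 : ∫ y, (nullPart R).indicator (fun _ => (1 : ℝ)) y ∂stepKernel θ ν R x
      = (stepKernel θ ν R x).real (nullPart R) := integral_indicator_one hm
  have e3 : stepOp θ ν R ((nullPart R)ᶜ.indicator fun _ => 1) x
      = (stepKernel θ ν R x).real (nullPart R)ᶜ := integral_indicator_one hm.compl
  rw [stepDev, stepOp, e1, e2] at hx
  rw [e3, probReal_compl_eq_one_sub hm, probReal_compl_eq_one_sub hm]
  linarith

/-- In the balanced case, `W` being the set of colours of mass `θ + m`. -/
lemma balanced_identity (hX : IsMVPS P X θ ν R) (hE : IsExchangeable P X) {m ε : ℝ}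
    {W : Set 𝕏} (hW : MeasurableSet W) (hWm : ∀ x ∈ W, urnMass θ R x = θ + m)
    (hWε : ∀ᵐ x ∂ν, stepOp θ ν R (W.indicator fun _ => 1) x = ε)
    {f a : 𝕏 → ℝ} (hf : BddMeas f) (ha : BddMeas a) (hfW : ∀ x ∉ W, f x = 0)
    (haW : ∀ x ∉ W, a x = 0) :
    (θ + m) * ∫ x, W.indicator (fun _ => 1) x * stepOp θ ν R f x * stepOp θ ν R a x ∂ν
      = m * ε * ∫ x, a x * stepOp θ ν R f x ∂ν + θ * ε * (∫ x, f x ∂ν) * ∫ x, a x ∂ν := by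
  have := hX.isProbabilityMeasure
  have m0 := hX.measurable 0
  have m1 := hX.measurable 1
  set e : 𝕏 → ℝ := W.indicator fun _ => 1 with he
  have heb : BddMeas e := BddMeas.indicator_one hW
  have hPf := hX.bddMeas_stepOp hf
  have hPa := hX.bddMeas_stepOp ha
  have hmul : ∀ {u : 𝕏 → ℝ}, BddMeas u → (∀ x ∉ W, u x = 0) →
      BddMeas fun x => urnMass θ R x * u x := fun {u} hu huW => by
    convert hu.const_mul (θ + m) using 1
    funext x
    by_cases hx : x ∈ W
    · rw [hWm x hx]
    · simp [huW x hx]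
  have heW : ∀ x ∉ W, e x = 0 := fun x hx => by simp [he, hx]
  have key := hX.pair_identity hE hf (hmul hf hfW) ha (hmul ha haW) heb (hmul heb heW)
  -- On W × W the two masses agree, so the predictive quotient in `pair_identity` is multiplied by
  -- zero; off W × W the factor a(X₀) e(X₁) vanishes.
  have e1 : ∀ ω, a (X 0 ω) * e (X 1 ω) *
      (urnMass θ R (X 0 ω) * stepOp θ ν R f (X 0 ω) - urnMass θ R (X 1 ω) * stepOp θ ν R f (X 1 ω)
      - (urnMass θ R (X 0 ω) - urnMass θ R (X 1 ω)) *
        ((urnMass θ R (X 0 ω) * stepOp θ ν R f (X 0 ω)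
          + urnMass θ R (X 1 ω) * stepOp θ ν R f (X 1 ω) - θ * ∫ y, f y ∂ν)
        / (urnMass θ R (X 0 ω) + urnMass θ R (X 1 ω) - θ)))
      = (θ + m) * ((a (X 0 ω) * stepOp θ ν R f (X 0 ω)) * e (X 1 ω)
        - a (X 0 ω) * (e (X 1 ω) * stepOp θ ν R f (X 1 ω))) := fun ω => by
    by_cases h0 : X 0 ω ∈ W
    · by_cases h1 : X 1 ω ∈ W
      · rw [hWm _ h0, hWm _ h1]
        ring
      · simp [heW _ h1]
    · simp [haW _ h0]
  have c1 := hX.integral_one_mul (ha.mul hPf) heb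
  have c2 := hX.integral_one_mul ha (heb.mul hPf)
  have c3 := hX.stepOp_symm hE ha (heb.mul hPf)
  have c4 : ∫ x, a x * stepOp θ ν R f x * stepOp θ ν R e x ∂ν
      = (∫ x, a x * stepOp θ ν R f x ∂ν) * ε := by
    rw [← integral_mul_const]
    refine integral_congr_ae ?_
    filter_upwards [hWε] with x hx
    rw [hx]
  have c5 : ∫ x, e x * stepOp θ ν R f x ∂ν = (∫ x, f x ∂ν) * ε := by
    rw [hX.stepOp_symm hE heb hf, ← integral_mul_const]
    refine integral_congr_ae ?_
    filter_upwards [hWε] with x hx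
    rw [hx]
  have c6 : ∫ x, e x ∂ν = ε := by
    rw [← hX.integral_stepOp hE heb]
    rw [integral_congr_ae hWε]
    simp
  simp only [e1] at key
  rw [integral_const_mul, (((ha.mul hPf).comp m0).mul (heb.comp m1)).integral_sub
    ((ha.comp m0).mul ((heb.mul hPf).comp m1)), c1, c2, c5, c6] at key
  change (θ + m) * (∫ x, a x * stepOp θ ν R f x * stepOp θ ν R e x ∂ν
    - ∫ x, a x * stepOp θ ν R (fun y => e y * stepOp θ ν R f y) x ∂ν) = _ at key
  rw [c3, c4] at key
  linear_combination -key

/-- In the balanced case, the normalized reinforcement is a projection in `L²(ν)`, whence its values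
are invariant. -/
lemma balanced_invariant (hX : IsMVPS P X θ ν R) (hE : IsExchangeable P X) {m ε : ℝ}
    (hm : 0 < m) (hε : 0 < ε)
    {W : Set 𝕏} (hW : MeasurableSet W) (hWm : ∀ x ∈ W, urnMass θ R x = θ + m)
    (hWε : ∀ᵐ x ∂ν, stepOp θ ν R (W.indicator fun _ => 1) x = ε)
    {f g : 𝕏 → ℝ} (hf : BddMeas f) (hfW : ∀ x ∉ W, f x = 0)
    (hg : ∀ x, m * ε * g x = (θ + m) * stepOp θ ν R f x - θ * ∫ y, f y ∂ν) :
    ∫ x, W.indicator (fun _ => 1) x * g x ∂ν = ∫ x, f x ∂ν ∧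
    ∀ᵐ x ∂ν, x ∈ W → ∀ᵐ y ∂(R x), y ∈ W → g y = g x := by
  have := hX.isProbabilityMeasure
  have := hX.isFiniteMeasure_kernel
  have hmε : m * ε ≠ 0 := (mul_pos hm hε).ne'
  set e : 𝕏 → ℝ := W.indicator fun _ => 1 with he
  have heb : BddMeas e := BddMeas.indicator_one hW
  have heW : ∀ x ∉ W, e x = 0 := fun x hx => by simp [he, hx]
  have hee : ∀ x, e x * e x = e x := fun x => by by_cases hx : x ∈ W <;> simp [he, hx]
  -- the normalized reinforcement operator
  let T : (𝕏 → ℝ) → 𝕏 → ℝ := fun u x =>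
    (m * ε)⁻¹ * ((θ + m) * stepOp θ ν R u x - θ * ∫ y, u y ∂ν)
  have hT : ∀ {u}, BddMeas u → BddMeas (T u) := fun hu =>
    (((hX.bddMeas_stepOp hu).const_mul _).sub (.const _)).const_mul _
  have hgT : g = T f := funext fun x => by
    simp only [T]
    rw [← hg x, inv_mul_cancel_left₀ hmε]
  have hgb : BddMeas g := hgT ▸ hT hf
  have hPe : ∫ x, e x ∂ν = ε := by
    rw [← hX.integral_stepOp hE heb, integral_congr_ae hWε]
    simp
  have heP : ∀ {u}, BddMeas u → ∫ x, e x * stepOp θ ν R u x ∂ν = (∫ x, u x ∂ν) * ε :=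
    fun {u} hu => by
      rw [hX.stepOp_symm hE heb hu, ← integral_mul_const]
      refine integral_congr_ae ?_
      filter_upwards [hWε] with x hx
      rw [hx]
  have L1 : ∀ {u}, BddMeas u → ∫ x, e x * T u x ∂ν = ∫ x, u x ∂ν := fun {u} hu => by
    have h1 : ∀ x, e x * T u x = (m * ε)⁻¹ * ((θ + m) * (e x * stepOp θ ν R u x)
        - (θ * ∫ y, u y ∂ν) * e x) := fun x => by
      simp only [T]
      ring
    simp only [h1]
    rw [integral_const_mul, ((heb.mul (hX.bddMeas_stepOp hu)).const_mul _).integral_sub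
      (heb.const_mul _), integral_const_mul, integral_const_mul, heP hu, hPe]
    field_simp
    ring
  -- For functions supported on W, this says that T, cut off to W, satisfies ⟨T u, T v⟩ = ⟨T u, v⟩:
  -- it is an orthogonal projection. It is `balanced_identity` rewritten in terms of T.
  have L2 : ∀ {u v}, BddMeas u → BddMeas v → (∀ x ∉ W, u x = 0) → (∀ x ∉ W, v x = 0) →
      ∫ x, e x * T u x * T v x ∂ν = ∫ x, v x * T u x ∂ν := fun {u v} hu hv huW hvW => by
    have hPu := hX.bddMeas_stepOp hu
    have hPv := hX.bddMeas_stepOp hv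
    have h1 : ∀ x, e x * T u x * T v x = ((m * ε)⁻¹) ^ 2 *
        (((θ + m) ^ 2 * (e x * stepOp θ ν R u x * stepOp θ ν R v x)
        - (θ + m) * θ * (∫ y, v y ∂ν) * (e x * stepOp θ ν R u x)) -
        ((θ + m) * θ * (∫ y, u y ∂ν) * (e x * stepOp θ ν R v x)
        - θ ^ 2 * (∫ y, u y ∂ν) * (∫ y, v y ∂ν) * e x)) := fun x => by
      simp only [T]
      ring
    have h2 : ∀ x, v x * T u x = (m * ε)⁻¹ * ((θ + m) * (v x * stepOp θ ν R u x)
        - (θ * ∫ y, u y ∂ν) * v x) := fun x => by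
      simp only [T]
      ring
    have key := hX.balanced_identity hE hW hWm hWε hu hv huW hvW
    rw [← he] at key
    simp only [h1, h2]
    rw [integral_const_mul, integral_const_mul,
      ((((heb.mul hPu).mul hPv).const_mul _).sub ((heb.mul hPu).const_mul _)).integral_sub
      (((heb.mul hPv).const_mul _).sub (heb.const_mul _)),
      (((heb.mul hPu).mul hPv).const_mul _).integral_sub ((heb.mul hPu).const_mul _),
      ((heb.mul hPv).const_mul _).integral_sub (heb.const_mul _),
      ((hv.mul hPu).const_mul _).integral_sub (hv.const_mul _)]
    simp only [integral_const_mul]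
    rw [heP hu, heP hv, hPe]
    field_simp
    linear_combination (θ + m) * key
  refine ⟨hgT ▸ L1 hf, ?_⟩
  -- the conditional variance of `g` under the reinforcement vanishes
  have hTR : ∀ {u : 𝕏 → ℝ}, BddMeas u → ∀ x ∈ W, m * ε * T u x = ∫ y, u y ∂(R x) :=
    fun {u} hu x hx => by
      have h := hX.integral_stepKernel x hu
      rw [hWm x hx] at h
      simp only [T, stepOp]
      rw [mul_inv_cancel_left₀ hmε, h]
      ring
  have heg := heb.mul hgb
  have hegg := (heb.mul hgb).mul hgb
  -- On W, m ε times this expression is ∫ (g(y) − g(x))² over y ∈ W against R_x, with the square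
  -- expanded. The factor e restricts to W, where m ε T is integration against R_x.
  have hVb : BddMeas fun x => (e x * T (fun y => e y * g y * g y) x
      - 2 * (e x * g x * T (fun y => e y * g y) x)) + e x * g x * g x * T e x :=
    ((heb.mul (hT hegg)).sub (((heg).mul (hT heg)).const_mul 2)).add (hegg.mul (hT heb))
  have hVint : ∀ x ∈ W, m * ε * ((e x * T (fun y => e y * g y * g y) x
      - 2 * (e x * g x * T (fun y => e y * g y) x)) + e x * g x * g x * T e x)
      = ∫ y, e y * (g y - g x) ^ 2 ∂(R x) := fun x hx => by
    have hex : e x = 1 := by simp [he, hx]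
    have h1 : ∀ y, e y * (g y - g x) ^ 2
        = (e y * g y * g y - 2 * g x * (e y * g y)) + g x * g x * e y := fun y => by ring
    simp only [h1]
    rw [(hegg.sub (heg.const_mul _)).integral_add (heb.const_mul _),
      hegg.integral_sub (heg.const_mul _), integral_const_mul, integral_const_mul,
      ← hTR hegg x hx, ← hTR heg x hx, ← hTR heb x hx, hex]
    ring
  have hV0 : ∀ x, 0 ≤ (e x * T (fun y => e y * g y * g y) x
      - 2 * (e x * g x * T (fun y => e y * g y) x)) + e x * g x * g x * T e x := fun x => by
    by_cases hx : x ∈ W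
    · refine nonneg_of_mul_nonneg_right ?_ (mul_pos hm hε)
      rw [hVint x hx]
      exact integral_nonneg fun y => mul_nonneg (Set.indicator_nonneg (fun _ _ => zero_le_one) y)
        (sq_nonneg _)
    · simp [heW x hx]
  have hTe : ∀ᵐ x ∂ν, T e x = 1 := by
    filter_upwards [hWε] with x hx
    simp only [T]
    rw [hx, hPe]
    field_simp
    ring
  -- With `L1`, `L2` and T e = 1 a.e., the three terms integrate to ∫ e g² − 2 ∫ e g² + ∫ e g² = 0.
  have hVzero : ∫ x, (e x * T (fun y => e y * g y * g y) x
      - 2 * (e x * g x * T (fun y => e y * g y) x)) + e x * g x * g x * T e x ∂ν = 0 := by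
    rw [((heb.mul (hT hegg)).sub ((heg.mul (hT heg)).const_mul 2)).integral_add
      (hegg.mul (hT heb)), (heb.mul (hT hegg)).integral_sub ((heg.mul (hT heg)).const_mul 2),
      integral_const_mul, L1 hegg]
    have k1 : ∫ x, e x * g x * T (fun y => e y * g y) x ∂ν = ∫ x, e x * g x * g x ∂ν := by
      have := L2 hf heg hfW (fun x hx => by rw [heW x hx, zero_mul])
      rwa [← hgT] at this
    have k2 : ∫ x, e x * g x * g x * T e x ∂ν = ∫ x, e x * g x * g x ∂ν := by
      refine integral_congr_ae ?_
      filter_upwards [hTe] with x hx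
      rw [hx, mul_one]
    rw [k1, k2]
    ring
  filter_upwards [(integral_eq_zero_iff_of_nonneg hV0 (hVb.integrable ν)).1 hVzero] with x hx hxW
  have h1 := hVint x hxW
  rw [show _ = (0 : ℝ) from hx, mul_zero] at h1
  have hb : BddMeas fun y => e y * (g y - g x) ^ 2 := by
    simpa only [sq] using heb.mul ((hgb.sub (.const _)).mul (hgb.sub (.const _)))
  have h2 := (integral_eq_zero_iff_of_nonneg (fun y => mul_nonneg
    (Set.indicator_nonneg (fun _ _ => zero_le_one) y) (sq_nonneg _)) (hb.integrable (R x))).1 h1.symm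
  filter_upwards [h2] with y hy hyW
  have hey : e y = 1 := by simp [he, hyW]
  have h3 : e y * (g y - g x) ^ 2 = 0 := hy
  rw [hey, one_mul] at h3
  exact sub_eq_zero.1 (pow_eq_zero_iff two_ne_zero |>.1 h3)

end IsMVPS

end Balanced

/-! ### From exchangeability to the mixture form -/

section MixtureForm

variable {Ω 𝕏 : Type*} [mΩ : MeasurableSpace Ω] [m𝕏 : MeasurableSpace 𝕏]

/-- The kernel `x ↦ R_x(· ∩ S) / (R_x(𝕏) c)`. -/
noncomputable def normalizedRestrict (R : Kernel 𝕏 𝕏) (c : ℝ≥0∞) {S : Set 𝕏}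
    (hS : MeasurableSet S) : Kernel 𝕏 𝕏 where
  toFun x := (R x Set.univ * c)⁻¹ • (R x).restrict S
  measurable' := by
    refine Measure.measurable_of_measurable_coe _ fun A hA => ?_
    simp only [Measure.smul_apply, smul_eq_mul, Measure.restrict_apply hA]
    exact ((R.measurable_coe MeasurableSet.univ).mul_const c).inv.mul
      (R.measurable_coe (hA.inter hS))

lemma normalizedRestrict_apply (R : Kernel 𝕏 𝕏) (c : ℝ≥0∞) {S : Set 𝕏}
    (hS : MeasurableSet S) (x : 𝕏) :
    normalizedRestrict R c hS x = (R x Set.univ * c)⁻¹ • (R x).restrict S := rfl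

lemma isFiniteKernel_normalizedRestrict (R : Kernel 𝕏 𝕏) {c : ℝ≥0∞} (hc0 : c ≠ 0) (hc : c ≠ ∞)
    {S : Set 𝕏} (hS : MeasurableSet S) : IsFiniteKernel (normalizedRestrict R c hS) := by
  refine ⟨⟨c⁻¹, ENNReal.inv_lt_top.2 (pos_iff_ne_zero.2 hc0), fun x => ?_⟩⟩
  rw [normalizedRestrict_apply, Measure.smul_apply, smul_eq_mul,
    Measure.restrict_apply MeasurableSet.univ,
    ENNReal.mul_inv (Or.inr hc) (Or.inr hc0), mul_right_comm]
  refine (mul_le_mul_left (mul_le_mul_right (measure_mono (Set.subset_univ _)) _) _).trans ?_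
  exact (mul_le_mul_left (ENNReal.inv_mul_le_one _) _).trans_eq (one_mul _)

namespace IsMVPS

variable {P : Measure Ω} {X : ℕ → Ω → 𝕏} {θ : ℝ} {ν : Measure 𝕏}
  {R : Kernel 𝕏 𝕏} [IsProbabilityMeasure P]

/-- Here g is a version of x ↦ κ_x(B), and the three conclusions are what `exists_condExpKernel_eq`
will ask of κ. In the balanced alternative g is the projection of the indicator of B; when D
vanishes, R_x is proportional to ν for each set and g is constant. -/
lemma exists_invariant_density (hX : IsMVPS P X θ ν R) (hE : IsExchangeable P X)
    (hZ : ν (nullPart R)ᶜ ≠ 0) {B : Set 𝕏} (hB : MeasurableSet B) (hBZ : B ⊆ (nullPart R)ᶜ) :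
    ∃ g : 𝕏 → ℝ, (∀ᵐ x ∂ν, x ∈ (nullPart R)ᶜ →
        (R x).real B = (R x).real Set.univ * ν.real (nullPart R)ᶜ * g x) ∧
      ∫ x in (nullPart R)ᶜ, g x ∂ν = ν.real B ∧
      ∀ᵐ x ∂ν, x ∈ (nullPart R)ᶜ → ∀ᵐ y ∂(R x), y ∈ (nullPart R)ᶜ → g y = g x := by
  have := hX.isProbabilityMeasure
  have := hX.isFiniteMeasure_kernel
  have hε : 0 < ν.real (nullPart R)ᶜ := ENNReal.toReal_pos hZ (measure_ne_top _ _)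
  have hr : ∀ x, urnMass θ R x - θ = (R x).real Set.univ := fun x => by simp [urnMass]
  have hl : Measurable (urnMass θ R) := measurable_urnMass
  rcases hX.balanced_or_stepDev_eq_zero hE hZ with ⟨m, hm, hbal⟩ | h
  -- W agrees with Zᶜ up to a ν-null set, but on W the mass is exactly θ + m at every point, as the
  -- balanced identities require.
  · set W : Set 𝕏 := {x | urnMass θ R x = θ + m} with hW
    have hWmeas : MeasurableSet W := measurableSet_eq_fun hl measurable_const
    have hWZ : W ⊆ (nullPart R)ᶜ := fun x hx => by
      rw [← hX.theta_lt_urnMass_iff, show urnMass θ R x = θ + m from hx]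
      linarith
    have hWae : ∀ᵐ x ∂ν, (x ∈ W ↔ x ∈ (nullPart R)ᶜ) := by
      filter_upwards [hbal] with x hx using ⟨fun h => hWZ h, hx⟩
    have hWε : ∀ᵐ x ∂ν, stepOp θ ν R (W.indicator fun _ => 1) x = ν.real (nullPart R)ᶜ := by
      have h1 : W.indicator (fun _ => (1 : ℝ)) =ᵐ[ν] (nullPart R)ᶜ.indicator fun _ => 1 := by
        filter_upwards [hWae] with x hx
        by_cases h : x ∈ W
        · rw [Set.indicator_of_mem h, Set.indicator_of_mem (hx.1 h)]
        · rw [Set.indicator_of_notMem h, Set.indicator_of_notMem (mt hx.2 h)]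
      filter_upwards [hX.stepOp_congr hE h1, hX.ae_stepOp_indicator_compl hE] with x h2 h3
      rw [h2, h3]
    have hBW := hB.inter hWmeas
    set f : 𝕏 → ℝ := (B ∩ W).indicator fun _ => 1 with hf
    have hfb : BddMeas f := BddMeas.indicator_one hBW
    set g : 𝕏 → ℝ := fun x => (m * ν.real (nullPart R)ᶜ)⁻¹ *
      ((θ + m) * stepOp θ ν R f x - θ * ∫ y, f y ∂ν) with hg
    have hmε : m * ν.real (nullPart R)ᶜ ≠ 0 := (mul_pos hm hε).ne'
    have hgm : ∀ x, m * ν.real (nullPart R)ᶜ * g x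
        = (θ + m) * stepOp θ ν R f x - θ * ∫ y, f y ∂ν := fun x =>
      mul_inv_cancel_left₀ hmε _
    obtain ⟨h1, h2⟩ := hX.balanced_invariant hE hm hε hWmeas (fun x hx => hx) hWε hfb
      (fun x hx => by simp [hf, hx]) hgm
    have hRW : ∀ᵐ x ∂ν, ∀ᵐ y ∂(R x), (y ∈ W ↔ y ∈ (nullPart R)ᶜ) := by
      filter_upwards [hX.ae_ae_stepKernel hE hWae] with x hx
      exact (hX.absolutelyContinuous_stepKernel x).ae_le hx
    refine ⟨g, ?_, ?_, ?_⟩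
    · filter_upwards [hWae, hRW] with x hx hRx hxZ
      have hxW := hx.2 hxZ
      have e1 : (R x).real B = (R x).real (B ∩ W) := by
        refine measureReal_congr ?_
        filter_upwards [hRx] with y hy
        exact propext ⟨fun h => ⟨h, hy.2 (hBZ h)⟩, fun h => h.1⟩
      have e2 : ∫ y, f y ∂(R x) = (R x).real (B ∩ W) := integral_indicator_one hBW
      have e3 := hX.integral_stepKernel x hfb
      have e4 : urnMass θ R x = θ + m := hxW
      rw [e1, ← hr, e4, add_sub_cancel_left, hgm, ← e2, ← e4, stepOp, e3]
      ring
    · rw [← integral_indicator measurableSet_nullPart.compl]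
      have e1 : ∫ y, f y ∂ν = ν.real (B ∩ W) := integral_indicator_one hBW
      have e2 : ν.real (B ∩ W) = ν.real B := by
        refine measureReal_congr ?_
        filter_upwards [hWae] with y hy
        exact propext ⟨fun h => h.1, fun h => ⟨h, hy.2 (hBZ h)⟩⟩
      rw [← e2, ← e1, ← h1]
      refine integral_congr_ae ?_
      filter_upwards [hWae] with x hx
      by_cases h : x ∈ W
      · rw [Set.indicator_of_mem (hx.1 h), Set.indicator_of_mem h, one_mul]
      · rw [Set.indicator_of_notMem (mt hx.2 h), Set.indicator_of_notMem h, zero_mul]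
    · filter_upwards [h2, hWae, hRW] with x hx hxW hRx hxZ
      filter_upwards [hx (hxW.2 hxZ), hRx] with y hy hyW hyZ
      exact hy (hyW.2 hyZ)
  · refine ⟨fun _ => ν.real B / ν.real (nullPart R)ᶜ, ?_, ?_, ae_of_all _ fun x _ =>
      ae_of_all _ fun y _ => rfl⟩
    · filter_upwards [h _ (BddMeas.indicator_one hB)] with x hx _
      rw [hX.kernel_real_eq x hB, hx, hr]
      field_simp
      ring
    · rw [setIntegral_const, smul_eq_mul, mul_div_cancel₀ _ hε.ne']

/-- Off the null part, an exchangeable sequence reinforces the null part proportionally to `ν`. -/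
lemma ae_kernel_apply_of_subset_nullPart (hX : IsMVPS P X θ ν R) (hE : IsExchangeable P X)
    {B : Set 𝕏} (hB : MeasurableSet B) (hBZ : B ⊆ nullPart R) :
    ∀ᵐ x ∂ν, R x B = R x Set.univ * ν B := by
  have := hX.isProbabilityMeasure
  have := hX.isFiniteMeasure_kernel
  have h := hX.ae_stepDev_eq_zero_of_support hE (BddMeas.indicator_one hB) fun x hx => by
    by_contra h
    have : x ∉ B := fun h' => h (hBZ h')
    simp [this] at hx
  filter_upwards [h] with x hx
  have h1 := hX.kernel_real_eq x hB
  rw [hx, mul_zero, add_zero, show urnMass θ R x - θ = (R x).real Set.univ by simp [urnMass],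
    measureReal_def, measureReal_def, measureReal_def, ← ENNReal.toReal_mul] at h1
  exact (ENNReal.toReal_eq_toReal_iff' (measure_ne_top _ _) (by finiteness)).1 h1

lemma exists_hasMixtureForm [StandardBorelSpace 𝕏] [IsProbabilityMeasure ν]
    (hX : IsMVPS P X θ ν R) (hE : IsExchangeable P X) (hZ0 : 0 < ν (nullPart R))
    (hZ1 : ν (nullPart R) < 1) :
    ∃ G : MeasurableSpace 𝕏, G ≤ m𝕏 ∧ CGUnder G ν ∧ MeasurableSet[G] (nullPart R)ᶜ ∧
      HasMixtureForm G ν R := by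
  classical
  have := hX.isFiniteMeasure_kernel
  have hZm : MeasurableSet (nullPart R) := measurableSet_nullPart
  have hc0 : ν (nullPart R)ᶜ ≠ 0 := by
    rw [prob_compl_eq_one_sub hZm]
    exact (tsub_pos_of_lt hZ1).ne'
  have hc : ν (nullPart R)ᶜ ≠ ∞ := measure_ne_top _ _
  have hε : 0 < ν.real (nullPart R)ᶜ := ENNReal.toReal_pos hc0 hc
  have := isFiniteKernel_normalizedRestrict R hc0 hc hZm.compl
  have : IsProbabilityMeasure (ν[|nullPart R]) := cond_isProbabilityMeasure hZ0.ne'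
  -- On Zᶜ this is the only candidate the mixture form leaves for ν(· | G). On Z, where the mixture
  -- form says nothing, ν(· | Z) is chosen so that κ preserves ν and is constant on Z.
  set κ : Kernel 𝕏 𝕏 := Kernel.piecewise hZm.compl
    (normalizedRestrict R (ν (nullPart R)ᶜ) hZm.compl) (Kernel.const _ (ν[|nullPart R])) with hκdef
  have : IsFiniteKernel κ := by
    rw [hκdef]
    infer_instance
  have hκ1 : ∀ x ∈ (nullPart R)ᶜ, κ x = (R x Set.univ * ν (nullPart R)ᶜ)⁻¹ •
      (R x).restrict (nullPart R)ᶜ := fun x hx => by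
    rw [hκdef, Kernel.piecewise_apply, if_pos hx, normalizedRestrict_apply]
  have hκ2 : ∀ x ∈ nullPart R, κ x = ν[|nullPart R] := fun x hx => by
    rw [hκdef, Kernel.piecewise_apply, if_neg (Set.notMem_compl_iff.2 hx), Kernel.const_apply]
  have hr : ∀ x ∈ (nullPart R)ᶜ, 0 < (R x).real Set.univ := fun x hx =>
    ENNReal.toReal_pos hx (measure_ne_top _ _)
  have hκreal : ∀ x ∈ (nullPart R)ᶜ, ∀ B, MeasurableSet B → ∀ t,
      (R x).real (B ∩ (nullPart R)ᶜ) = (R x).real Set.univ * ν.real (nullPart R)ᶜ * t →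
      (κ x B).toReal = t := fun x hx B hB t ht => by
    rw [hκ1 x hx, Measure.smul_apply, Measure.restrict_apply hB, smul_eq_mul, ENNReal.toReal_mul,
      ENNReal.toReal_inv, ENNReal.toReal_mul, ← measureReal_def, ← measureReal_def,
      ← measureReal_def, ht, inv_mul_cancel_left₀ (mul_pos (hr x hx) hε).ne']
  have hinv : ∀ B, MeasurableSet B → ∫⁻ x, κ x B ∂ν = ν B := fun B hB => by
    obtain ⟨g, hg1, hg2, -⟩ := hX.exists_invariant_density hE hc0 (hB.inter hZm.compl)
      Set.inter_subset_right
    have k1 : ∫⁻ x in (nullPart R)ᶜ, κ x B ∂ν = ν (B ∩ (nullPart R)ᶜ) := by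
      have hbdd : ∫⁻ x in (nullPart R)ᶜ, κ x B ∂ν ≠ ∞ := by
        refine ((setLIntegral_mono measurable_const fun x _ =>
          Kernel.measure_le_bound κ x B).trans_lt ?_).ne
        rw [setLIntegral_const]
        exact ENNReal.mul_lt_top (Kernel.bound_lt_top κ) hc.lt_top
      refine (ENNReal.toReal_eq_toReal_iff' hbdd (measure_ne_top _ _)).1 ?_
      rw [← integral_toReal (κ.measurable_coe hB).aemeasurable
        (ae_of_all _ fun x => measure_lt_top _ _), ← measureReal_def, ← hg2]
      refine setIntegral_congr_ae hZm.compl ?_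
      filter_upwards [hg1] with x hx hxZ
      exact hκreal x hxZ B hB _ (hx hxZ)
    have k2 : ∫⁻ x in nullPart R, κ x B ∂ν = ν (B ∩ nullPart R) := by
      rw [setLIntegral_congr_fun hZm fun x hx => by rw [hκ2 x hx], setLIntegral_const,
        cond_mul_eq_inter hZm, Set.inter_comm]
    rw [← lintegral_add_compl _ hZm, k1, k2, ← Set.sdiff_eq,
      measure_inter_add_sdiff B hZm]
  have hκnull : ∀ {q : 𝕏 → Prop}, (∀ᵐ y ∂ν, q y) → ∀ᵐ x ∂ν, ∀ᵐ y ∂κ x, q y := fun {q} hq => by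
    obtain ⟨N, hN, hNm, hN0⟩ := exists_measurable_superset_of_null hq
    have h := hinv N hNm
    rw [hN0, lintegral_eq_zero_iff (κ.measurable_coe hNm)] at h
    filter_upwards [h] with x hx using measure_mono_null hN hx
  have hκZ1 : ∀ x ∈ (nullPart R)ᶜ, ∀ᵐ y ∂κ x, y ∈ (nullPart R)ᶜ := fun x hx => by
    rw [hκ1 x hx]
    exact Measure.ae_smul_measure (ae_restrict_mem hZm.compl) _
  have hκZ2 : ∀ x ∈ nullPart R, ∀ᵐ y ∂κ x, y ∈ nullPart R := fun x hx => by
    rw [hκ2 x hx]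
    exact Measure.ae_smul_measure (ae_restrict_mem hZm) _
  -- the reinforcement of the null part
  have := isFiniteKernel_normalizedRestrict R one_ne_zero ENNReal.one_ne_top hZm
  -- Both kernels are given the same value on Z, so that the a.e. comparison set by set becomes an
  -- a.e. equality of measures over the whole space.
  have hZpart : ∀ᵐ x ∂ν, (Kernel.piecewise hZm.compl
      (normalizedRestrict R 1 hZm) (Kernel.const _ (ν.restrict (nullPart R)))) x
      = Kernel.const _ (ν.restrict (nullPart R)) x := by
    refine kernel_ae_eq_of_forall fun B hB => ?_
    filter_upwards [hX.ae_kernel_apply_of_subset_nullPart hE (hB.inter hZm)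
      Set.inter_subset_right] with x hx
    rw [Kernel.piecewise_apply]
    split_ifs with h
    · rw [normalizedRestrict_apply, Measure.smul_apply, Measure.restrict_apply hB, smul_eq_mul, hx,
        mul_one, Kernel.const_apply, Measure.restrict_apply hB, ← mul_assoc,
        ENNReal.inv_mul_cancel h (measure_ne_top _ _), one_mul]
    · rfl
  have hform : ∀ᵐ x ∂ν, x ∈ (nullPart R)ᶜ → (R x Set.univ)⁻¹ • R x
      = ν (nullPart R)ᶜ • κ x + ν (nullPart R) • ν[|nullPart R] := by
    filter_upwards [hZpart] with x hx2 hxZ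
    rw [Kernel.piecewise_apply, if_pos hxZ, normalizedRestrict_apply, mul_one, Kernel.const_apply]
      at hx2
    have e1 : ν (nullPart R) • ν[|nullPart R] = ν.restrict (nullPart R) := by
      rw [ProbabilityTheory.cond, smul_smul, ENNReal.mul_inv_cancel hZ0.ne' (measure_ne_top _ _),
        one_smul]
    rw [e1, ← hx2, hκ1 x hxZ, smul_smul, ENNReal.mul_inv (Or.inr hc) (Or.inr hc0),
      mul_left_comm, ENNReal.mul_inv_cancel hc0 hc, mul_one, ← smul_add, add_comm,
      Measure.restrict_add_restrict_compl hZm]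
  obtain ⟨G, hG, hCG, hZG, hGκ⟩ := exists_condExpKernel_eq ν κ hZm.compl hinv
    (ae_of_all _ fun x => by
      by_cases hx : x ∈ nullPart R
      · filter_upwards [hκZ2 x hx] with y hy
        simp [hx, hy]
      · filter_upwards [hκZ1 x hx] with y hy
        exact ⟨fun _ => hx, fun _ => hy⟩)
    (fun B hB => by
      obtain ⟨g, hg1, -, hg3⟩ := hX.exists_invariant_density hE hc0 (hB.inter hZm.compl)
        Set.inter_subset_right
      have hgκ : ∀ᵐ x ∂ν, x ∈ (nullPart R)ᶜ → (κ x B).toReal = g x := by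
        filter_upwards [hg1] with x hx hxZ
        exact hκreal x hxZ B hB _ (hx hxZ)
      filter_upwards [hgκ, hκnull hgκ, hg3] with x hx1 hx2 hx3
      by_cases hx : x ∈ nullPart R
      · filter_upwards [hκZ2 x hx] with y hy
        rw [hκ2 x hx, hκ2 y hy]
      · have hac : κ x ≪ R x := by
          rw [hκ1 x hx]
          exact Measure.AbsolutelyContinuous.smul_left
            (Measure.absolutelyContinuous_of_le Measure.restrict_le_self) _
        filter_upwards [hκZ1 x hx, hx2, hac.ae_le (hx3 hx)] with y hy1 hy2 hy3
        refine (ENNReal.toReal_eq_toReal_iff' (measure_ne_top _ _) (measure_ne_top _ _)).1 ?_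
        rw [hy2 hy1, hx1 hx, hy3 hy1])
  refine ⟨G, hG, hCG, hZG, ?_⟩
  filter_upwards [hGκ, hform] with x hx1 hx2 hxZ
  rw [← hx1]
  exact hx2 hxZ

end IsMVPS

end MixtureForm

/-! ### Symmetry properties of conditional distributions -/

section CondExpKernel

variable {𝕏 : Type*}

/-- The conditional distribution disintegrates the image of ν on the diagonal, with first coordinate
seen through G. Every property in `IsInvariantKernel` follows by a choice of F. -/
lemma lintegral_lintegral_condExpKernel {G : MeasurableSpace 𝕏} {m𝕏 : MeasurableSpace 𝕏}
    [StandardBorelSpace 𝕏] {ν : Measure 𝕏} [IsFiniteMeasure ν] (hG : G ≤ m𝕏)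
    {F : 𝕏 × 𝕏 → ℝ≥0∞} (hF : Measurable[G.prod m𝕏] F) :
    ∫⁻ x, ∫⁻ y, F (x, y) ∂condExpKernel ν G x ∂ν.trim hG = ∫⁻ x, F (x, x) ∂ν := by
  have hdiag : @Measurable 𝕏 (𝕏 × 𝕏) m𝕏 (G.prod m𝕏) Function.diag :=
    (measurable_id'' hG).prodMk measurable_id
  rw [← Measure.lintegral_compProd hF, compProd_trim_condExpKernel hG]
  exact @lintegral_map _ _ m𝕏 (G.prod m𝕏) ν F Function.diag hF hdiag

/-- The properties of a conditional distribution of `ν` given a σ-algebra containing `W` on which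
the exchangeability of an urn depends. -/
structure IsInvariantKernel {m𝕏 : MeasurableSpace 𝕏} (ν : Measure 𝕏) (κ : Kernel 𝕏 𝕏)
    (W : Set 𝕏) : Prop where
  apply_compl : ∀ᵐ x ∂ν, x ∈ W → κ x Wᶜ = 0
  ae_ae : ∀ {q : 𝕏 → Prop}, (∀ᵐ y ∂ν, q y) → ∀ᵐ x ∂ν, ∀ᵐ y ∂κ x, q y
  symm : ∀ A B, MeasurableSet A → MeasurableSet B →
    ∫⁻ x in A ∩ W, κ x B ∂ν = ∫⁻ x in B ∩ W, κ x A ∂ν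
  setLIntegral : ∀ A B, MeasurableSet A → MeasurableSet B →
    ∀ᵐ y ∂ν, ∫⁻ x in A, κ x B ∂κ y = κ y A * κ y B

lemma isInvariantKernel_condExpKernel {G : MeasurableSpace 𝕏} {m𝕏 : MeasurableSpace 𝕏}
    [StandardBorelSpace 𝕏] {ν : Measure 𝕏} [IsFiniteMeasure ν] (hG : G ≤ m𝕏) {W : Set 𝕏}
    (hW : MeasurableSet[G] W) {κ : Kernel 𝕏 𝕏} (hκ : ∀ x, κ x = condExpKernel ν G x) :
    IsInvariantKernel ν κ W := by
  have hWm : MeasurableSet W := hG W hW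
  have hmeas : ∀ {B}, MeasurableSet B → Measurable[G] fun x => κ x B := fun {B} hB => by
    simp only [hκ]
    exact measurable_condExpKernel hB
  have key : ∀ {F : 𝕏 × 𝕏 → ℝ≥0∞}, Measurable[G.prod m𝕏] F →
      ∫⁻ x, ∫⁻ y, F (x, y) ∂κ x ∂ν.trim hG = ∫⁻ x, F (x, x) ∂ν := fun hF => by
    simp only [hκ]
    exact lintegral_lintegral_condExpKernel hG hF
  have h1 : ∀ {C}, MeasurableSet[G] C → Measurable[G.prod m𝕏]
      fun q : 𝕏 × 𝕏 => C.indicator (fun _ => (1 : ℝ≥0∞)) q.1 := fun {C} hC =>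
    ((@measurable_const ℝ≥0∞ 𝕏 _ G 1).indicator hC).comp
      (@measurable_fst 𝕏 𝕏 G m𝕏)
  have h2 : ∀ {A}, MeasurableSet A → Measurable[G.prod m𝕏]
      fun q : 𝕏 × 𝕏 => A.indicator (fun _ => (1 : ℝ≥0∞)) q.2 := fun {A} hA =>
    (measurable_const.indicator hA).comp (@measurable_snd 𝕏 𝕏 G m𝕏)
  have hmeas1 : ∀ {B}, MeasurableSet B → Measurable[G.prod m𝕏]
      fun q : 𝕏 × 𝕏 => κ q.1 B := fun {B} hB =>
    (hmeas hB).comp (@measurable_fst 𝕏 𝕏 G m𝕏)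
  have hmeas2 : ∀ {B}, MeasurableSet B → Measurable[G.prod m𝕏]
      fun q : 𝕏 × 𝕏 => κ q.2 B := fun {B} hB =>
    (κ.measurable_coe hB).comp (@measurable_snd 𝕏 𝕏 G m𝕏)
  have hindint : ∀ {A} (f : 𝕏 → ℝ≥0∞) (μ : Measure 𝕏), MeasurableSet A →
      ∫⁻ x, A.indicator (fun _ => (1 : ℝ≥0∞)) x * f x ∂μ = ∫⁻ x in A, f x ∂μ := fun {A} f μ hA => by
    rw [← lintegral_indicator hA]
    refine lintegral_congr fun x => ?_
    by_cases hx : x ∈ A <;> simp [hx]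
  have hae : ∀ {q : 𝕏 → Prop}, (∀ᵐ y ∂ν, q y) → ∀ᵐ x ∂ν, ∀ᵐ y ∂κ x, q y := fun {q} hq => by
    obtain ⟨N, hN, hNm, hN0⟩ := exists_measurable_superset_of_null hq
    have h := key (h2 hNm)
    simp only [lintegral_indicator_const hNm, one_mul, hN0] at h
    rw [@lintegral_eq_zero_iff 𝕏 G _ _ (hmeas hNm)] at h
    filter_upwards [ae_of_ae_trim hG h] with x hx using measure_mono_null hN hx
  refine ⟨?_, hae, fun A B hA hB => ?_, fun A B hA hB => ?_⟩
  · have h := key ((h1 hW).mul (h2 hWm.compl))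
    have e1 : ∀ x, W.indicator (fun _ => (1 : ℝ≥0∞)) x * Wᶜ.indicator (fun _ => 1) x = 0 :=
      fun x => by by_cases hx : x ∈ W <;> simp [hx]
    simp only [Pi.mul_apply, e1, lintegral_zero] at h
    have e2 : ∀ x, ∫⁻ y, W.indicator (fun _ => (1 : ℝ≥0∞)) x * Wᶜ.indicator (fun _ => 1) y ∂κ x
        = W.indicator (fun _ => (1 : ℝ≥0∞)) x * κ x Wᶜ := fun x => by
      rw [lintegral_const_mul _ (measurable_const.indicator hWm.compl),
        lintegral_indicator_const hWm.compl, one_mul]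
    simp only [e2] at h
    have hm : Measurable[G] fun x => W.indicator (fun _ => (1 : ℝ≥0∞)) x * κ x Wᶜ :=
      ((@measurable_const ℝ≥0∞ 𝕏 _ G 1).indicator hW).mul (hmeas hWm.compl)
    rw [@lintegral_eq_zero_iff 𝕏 G _ _ hm] at h
    filter_upwards [ae_of_ae_trim hG h] with x hx hxW
    simpa [hxW] using hx
  -- With F(x, y) = 1_W(x) 1_A(y) κ_x(B), the integral becomes that of 1_W κ(A) κ(B), which is
  -- symmetric in A and B.
  · have hS : ∀ {A B}, MeasurableSet A → MeasurableSet B → ∫⁻ x in A ∩ W, κ x B ∂ν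
        = ∫⁻ x, W.indicator (fun _ => (1 : ℝ≥0∞)) x * (κ x A * κ x B) ∂ν.trim hG :=
      fun {A B} hA hB => by
        have h := key (((h1 hW).mul (h2 hA)).mul (hmeas1 hB))
        have e1 : ∀ x, ∫⁻ y, W.indicator (fun _ => (1 : ℝ≥0∞)) x * A.indicator (fun _ => 1) y
            * κ x B ∂κ x = W.indicator (fun _ => (1 : ℝ≥0∞)) x * (κ x A * κ x B) := fun x => by
          simp only [mul_assoc]
          rw [lintegral_const_mul _ ((measurable_const.indicator hA).mul_const _),
            lintegral_mul_const _ (measurable_const.indicator hA), lintegral_indicator_const hA,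
            one_mul]
        simp only [Pi.mul_apply, e1] at h
        rw [h, ← hindint _ _ (hA.inter hWm)]
        refine lintegral_congr fun x => ?_
        by_cases hx : x ∈ A <;> by_cases hx' : x ∈ W <;> simp [hx, hx']
    rw [hS hA hB, hS hB hA]
    simp only [mul_comm (κ _ A)]
  -- For C ∈ G, the functions 1_C(x) 1_A(y) κ_x(B) and 1_C(x) 1_A(y) κ_y(B) agree on the diagonal,
  -- hence have equal integrals. The exceptional null set depends on A and B; not asking for κ_x =
  -- κ_y as measures is what avoids countable generation of G.
  · have hm1 : Measurable[G] fun y => ∫⁻ x in A, κ x B ∂κ y := by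
      simp only [← hindint _ _ hA]
      simp only [hκ]
      exact @Measurable.lintegral_kernel 𝕏 𝕏 G m𝕏 (condExpKernel ν G) _ (by
        simp only [← hκ]
        exact (measurable_const.indicator hA).mul (κ.measurable_coe hB))
    have hm2 : Measurable[G] fun y => κ y A * κ y B := (hmeas hA).mul (hmeas hB)
    refine ae_of_ae_trim hG (@ae_eq_of_forall_setLIntegral_eq_of_sigmaFinite 𝕏 G (ν.trim hG) _ _ _
      hm1 hm2 fun C hC _ => ?_)
    have k1 := key (((h1 hC).mul (h2 hA)).mul (hmeas1 hB))
    have k2 := key (((h1 hC).mul (h2 hA)).mul (hmeas2 hB))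
    simp only [Pi.mul_apply] at k1 k2
    have k3 := k2.trans k1.symm
    have e1 : ∀ x, ∫⁻ y, C.indicator (fun _ => (1 : ℝ≥0∞)) x * A.indicator (fun _ => 1) y
        * κ x B ∂κ x = C.indicator (fun x => κ x A * κ x B) x := fun x => by
      simp only [mul_assoc]
      rw [lintegral_const_mul _ ((measurable_const.indicator hA).mul_const _),
        lintegral_mul_const _ (measurable_const.indicator hA), lintegral_indicator_const hA,
        one_mul]
      by_cases hx : x ∈ C <;> simp [hx]
    have e2 : ∀ x, ∫⁻ y, C.indicator (fun _ => (1 : ℝ≥0∞)) x * A.indicator (fun _ => 1) y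
        * κ y B ∂κ x = C.indicator (fun x => ∫⁻ y in A, κ y B ∂κ x) x := fun x => by
      simp only [mul_assoc]
      rw [lintegral_const_mul (f := fun y => A.indicator (fun _ => 1) y * κ y B) _
        ((measurable_const.indicator hA).mul (κ.measurable_coe hB)), hindint _ _ hA]
      by_cases hx : x ∈ C <;> simp [hx]
    simp only [e1, e2] at k3
    rwa [@lintegral_indicator 𝕏 G _ _ hC, @lintegral_indicator 𝕏 G _ _ hC] at k3

end CondExpKernel

/-! ### Symmetry of the next two draws under the mixture form -/

section TwoStep

variable {𝕏 : Type*} [m𝕏 : MeasurableSpace 𝕏]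

/-- Up to normalization, the probability that the next two observations fall in `A` and `B`, given
the observations `w`. -/
noncomputable def twoStep (θ : ℝ) (ν : Measure 𝕏) (R : Kernel 𝕏 𝕏) {n : ℕ} (w : Fin n → 𝕏)
    (A B : Set 𝕏) : ℝ≥0∞ :=
  ∫⁻ x in A, (urnMeasure θ ν R w Set.univ + R x Set.univ)⁻¹ * (urnMeasure θ ν R w B + R x B)
    ∂urnMeasure θ ν R w

/-- At the colour `x`, the reinforcement has mass `m` and mixture form with kernel `κ`. -/
def IsMixtureAt (ν : Measure 𝕏) (R κ : Kernel 𝕏 𝕏) (m : ℝ≥0∞) (x : 𝕏) : Prop :=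
  R x Set.univ = m ∧ R x = m • (ν (nullPart R)ᶜ • κ x + ν.restrict (nullPart R))

lemma kernel_eq_zero_of_mem_nullPart {R : Kernel 𝕏 𝕏} {x : 𝕏} (hx : x ∈ nullPart R) : R x = 0 :=
  Measure.measure_univ_eq_zero.1 hx

variable {ν : Measure 𝕏} {R κ : Kernel 𝕏 𝕏} {m : ℝ≥0∞}

lemma ae_ae_of_isMixtureAt (hκ : IsInvariantKernel ν κ (nullPart R)ᶜ)
    (hU : ∀ᵐ x ∂ν, x ∈ (nullPart R)ᶜ → IsMixtureAt ν R κ m x) {q : 𝕏 → Prop}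
    (hq : ∀ᵐ y ∂ν, q y) : ∀ᵐ x ∂ν, ∀ᵐ y ∂(R x), q y := by
  filter_upwards [hU, hκ.ae_ae hq] with x hx hκx
  by_cases hxZ : x ∈ nullPart R
  · rw [kernel_eq_zero_of_mem_nullPart hxZ]
    simp
  · rw [(hx hxZ).2]
    refine Measure.ae_smul_measure ?_ _
    rw [ae_add_measure_iff]
    exact ⟨Measure.ae_smul_measure hκx _, ae_restrict_of_ae hq⟩

/-- A colour after which the predictive probabilities of `A` and `B` are symmetric. -/
structure IsRegularAt (ν : Measure 𝕏) (R κ : Kernel 𝕏 𝕏) (m : ℝ≥0∞) (A B : Set 𝕏) (x : 𝕏) :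
    Prop where
  ae_kernel : ∀ᵐ y ∂(R x), y ∈ (nullPart R)ᶜ → IsMixtureAt ν R κ m y
  mixture : x ∈ (nullPart R)ᶜ → IsMixtureAt ν R κ m x
  null : x ∈ (nullPart R)ᶜ → κ x (nullPart R) = 0
  symm : ∫⁻ y in A, κ y B ∂κ x = ∫⁻ y in B, κ y A ∂κ x

lemma ae_isRegularAt (hκ : IsInvariantKernel ν κ (nullPart R)ᶜ)
    (hU : ∀ᵐ x ∂ν, x ∈ (nullPart R)ᶜ → IsMixtureAt ν R κ m x) {A B : Set 𝕏}
    (hA : MeasurableSet A) (hB : MeasurableSet B) : ∀ᵐ x ∂ν, IsRegularAt ν R κ m A B x := by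
  filter_upwards [ae_ae_of_isMixtureAt hκ hU hU, hU, hκ.apply_compl, hκ.setLIntegral A B hA hB,
    hκ.setLIntegral B A hB hA] with x h1 h2 h3 h4 h5
  refine ⟨h1, h2, fun hx => ?_, ?_⟩
  · simpa using h3 hx
  · rw [h4, h5, mul_comm]

lemma IsRegularAt.symm' {A B : Set 𝕏} {x : 𝕏} (h : IsRegularAt ν R κ m A B x) :
    IsRegularAt ν R κ m B A x :=
  ⟨h.ae_kernel, h.mixture, h.null, h.symm.symm⟩

variable {θ : ℝ} {n : ℕ} {w : Fin n → 𝕏} {A B : Set 𝕏}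

/-- Each contribution to the urn, initial or from a draw, restricted to Z is its total mass times ν.
-/
lemma urnMeasure_inter_nullPart [IsProbabilityMeasure ν]
    (hw : ∀ i, IsRegularAt ν R κ m A B (w i)) (C : Set 𝕏) (hC : MeasurableSet C) :
    urnMeasure θ ν R w (C ∩ nullPart R)
      = urnMeasure θ ν R w Set.univ * ν (C ∩ nullPart R) := by
  have hZ : MeasurableSet (nullPart R) := measurableSet_nullPart
  rw [urnMeasure_apply, urnMeasure_apply, measure_univ, mul_one, add_mul, Finset.sum_mul]
  congr 1
  refine Finset.sum_congr rfl fun i _ => ?_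
  by_cases hi : w i ∈ nullPart R
  · simp [kernel_eq_zero_of_mem_nullPart hi]
  · obtain ⟨h1, h2⟩ := (hw i).mixture hi
    rw [h1, h2]
    simp only [Measure.smul_apply, Measure.add_apply, smul_eq_mul,
      Measure.restrict_apply (hC.inter hZ), Set.inter_assoc, Set.inter_self]
    rw [measure_mono_null Set.inter_subset_right ((hw i).null hi), mul_zero, zero_add]

lemma ae_urnMeasure (hU : ∀ᵐ x ∂ν, x ∈ (nullPart R)ᶜ → IsMixtureAt ν R κ m x)
    (hw : ∀ i, IsRegularAt ν R κ m A B (w i)) :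
    ∀ᵐ x ∂urnMeasure θ ν R w, x ∈ (nullPart R)ᶜ → IsMixtureAt ν R κ m x := by
  rw [ae_iff, urnMeasure_apply, ae_iff.1 hU, mul_zero, zero_add]
  exact Finset.sum_eq_zero fun i _ => ae_iff.1 (hw i).ae_kernel

/-- The part of the urn from ν is symmetric by self-adjointness of conditional expectation. The part
from a colour x off Z is m ν(Zᶜ) times an integral against κ_x, symmetric by regularity at x. -/
lemma setLIntegral_urnMeasure_symm (hκ : IsInvariantKernel ν κ (nullPart R)ᶜ)
    (hA : MeasurableSet A) (hB : MeasurableSet B) (hw : ∀ i, IsRegularAt ν R κ m A B (w i)) :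
    ∫⁻ x in A ∩ (nullPart R)ᶜ, κ x B ∂urnMeasure θ ν R w
      = ∫⁻ x in B ∩ (nullPart R)ᶜ, κ x A ∂urnMeasure θ ν R w := by
  have hZ : MeasurableSet (nullPart R) := measurableSet_nullPart
  have expand : ∀ {C D : Set 𝕏}, MeasurableSet C →
      ∫⁻ x in C ∩ (nullPart R)ᶜ, κ x D ∂urnMeasure θ ν R w
      = ENNReal.ofReal θ * ∫⁻ x in C ∩ (nullPart R)ᶜ, κ x D ∂ν
        + ∑ i, ∫⁻ x in C ∩ (nullPart R)ᶜ, κ x D ∂(R (w i)) := fun {C D} hC => by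
    simp only [← lintegral_indicator (hC.inter hZ.compl)]
    rw [urnMeasure, lintegral_add_measure, lintegral_smul_measure, smul_eq_mul,
      lintegral_finsetSum_measure]
  have term : ∀ {C D : Set 𝕏}, MeasurableSet C → MeasurableSet D →
      ∀ x ∈ (nullPart R)ᶜ, IsRegularAt ν R κ m C D x →
      ∫⁻ y in C ∩ (nullPart R)ᶜ, κ y D ∂(R x)
        = m * (ν (nullPart R)ᶜ * ∫⁻ y in C, κ y D ∂κ x) := fun {C D} hC hD x hx h => by
    rw [(h.mixture hx).2, ← lintegral_indicator (hC.inter hZ.compl), lintegral_smul_measure,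
      lintegral_add_measure, lintegral_smul_measure, lintegral_indicator (hC.inter hZ.compl),
      lintegral_indicator (hC.inter hZ.compl), Measure.restrict_restrict (hC.inter hZ.compl),
      Set.inter_assoc, Set.compl_inter_self, Set.inter_empty, Measure.restrict_empty,
      lintegral_zero_measure, add_zero, smul_eq_mul, smul_eq_mul]
    congr 2
    refine setLIntegral_congr ?_
    have h0 : ∀ᵐ y ∂κ x, y ∉ nullPart R := measure_eq_zero_iff_ae_notMem.1 (h.null hx)
    filter_upwards [h0] with y hy
    exact propext ⟨fun h => h.1, fun h => ⟨h, hy⟩⟩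
  rw [expand hA, expand hB, hκ.symm A B hA hB]
  congr 1
  refine Finset.sum_congr rfl fun i _ => ?_
  by_cases hi : w i ∈ nullPart R
  · simp [kernel_eq_zero_of_mem_nullPart hi]
  · rw [term hA hB _ hi (hw i), term hB hA _ hi (hw i).symm', (hw i).symm]

/-- A first draw in Z leaves the total mass at s, and one in Zᶜ raises it to s + m. After expansion,
every term is visibly symmetric in A and B except the last integral. -/
lemma twoStep_eq [IsProbabilityMeasure ν] (hθ : 0 < θ) (hR : ∀ x, R x Set.univ ≠ ∞) (hm : m ≠ ∞)
    (hU : ∀ᵐ x ∂ν, x ∈ (nullPart R)ᶜ → IsMixtureAt ν R κ m x)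
    (hA : MeasurableSet A) (hB : MeasurableSet B) (hw : ∀ i, IsRegularAt ν R κ m A B (w i)) :
    twoStep θ ν R w A B = urnMeasure θ ν R w Set.univ * ν (A ∩ nullPart R) * ν (B ∩ nullPart R)
      + (ν (A ∩ nullPart R) * urnMeasure θ ν R w (B ∩ (nullPart R)ᶜ)
        + urnMeasure θ ν R w (A ∩ (nullPart R)ᶜ) * ν (B ∩ nullPart R))
      + (urnMeasure θ ν R w Set.univ + m)⁻¹ *
        (urnMeasure θ ν R w (A ∩ (nullPart R)ᶜ) * urnMeasure θ ν R w (B ∩ (nullPart R)ᶜ)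
          + m * ν (nullPart R)ᶜ * ∫⁻ x in A ∩ (nullPart R)ᶜ, κ x B ∂urnMeasure θ ν R w) := by
  have hZ : MeasurableSet (nullPart R) := measurableSet_nullPart
  have hs0 : urnMeasure θ ν R w Set.univ ≠ 0 := by
    rw [urnMeasure_apply]
    simp [hθ]
  have hs : urnMeasure θ ν R w Set.univ ≠ ∞ := by
    rw [urnMeasure_apply]
    simpa using fun i => hR (w i)
  set Λ := urnMeasure θ ν R w with hΛ
  set s := Λ Set.univ with hsdef
  have hΛA : Λ (A ∩ nullPart R) = s * ν (A ∩ nullPart R) := urnMeasure_inter_nullPart hw A hA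
  have hΛB : Λ B = s * ν (B ∩ nullPart R) + Λ (B ∩ (nullPart R)ᶜ) := by
    rw [← measure_inter_add_sdiff B hZ, hΛ, urnMeasure_inter_nullPart hw B hB, Set.sdiff_eq]
  have h1 : ∫⁻ x in A ∩ nullPart R, (s + R x Set.univ)⁻¹ * (Λ B + R x B) ∂Λ
      = ν (A ∩ nullPart R) * Λ B := by
    have e : ∀ x ∈ A ∩ nullPart R, (s + R x Set.univ)⁻¹ * (Λ B + R x B) = s⁻¹ * Λ B :=
      fun x hx => by simp [kernel_eq_zero_of_mem_nullPart hx.2]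
    rw [setLIntegral_congr_fun (hA.inter hZ) e, setLIntegral_const, hΛA]
    calc s⁻¹ * Λ B * (s * ν (A ∩ nullPart R)) = s⁻¹ * s * (ν (A ∩ nullPart R) * Λ B) := by ring
      _ = _ := by rw [ENNReal.inv_mul_cancel hs0 hs, one_mul]
  have h2 : ∫⁻ x in A ∩ (nullPart R)ᶜ, (s + R x Set.univ)⁻¹ * (Λ B + R x B) ∂Λ
      = (s + m)⁻¹ * (Λ B * Λ (A ∩ (nullPart R)ᶜ)
        + m * (ν (nullPart R)ᶜ * ∫⁻ x in A ∩ (nullPart R)ᶜ, κ x B ∂Λ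
          + ν (B ∩ nullPart R) * Λ (A ∩ (nullPart R)ᶜ))) := by
    have e : ∀ᵐ x ∂Λ, x ∈ A ∩ (nullPart R)ᶜ → (s + R x Set.univ)⁻¹ * (Λ B + R x B)
        = (s + m)⁻¹ * (Λ B + m * (ν (nullPart R)ᶜ * κ x B + ν (B ∩ nullPart R))) := by
      filter_upwards [ae_urnMeasure (θ := θ) hU hw] with x hx hxA
      obtain ⟨k1, k2⟩ := hx hxA.2
      rw [k1, k2]
      simp only [Measure.smul_apply, Measure.add_apply, smul_eq_mul, Measure.restrict_apply hB]
    have hκm := κ.measurable_coe hB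
    rw [setLIntegral_congr_fun_ae (hA.inter hZ.compl) e, lintegral_const_mul _ (by fun_prop),
      lintegral_add_left measurable_const, setLIntegral_const,
      lintegral_const_mul _ (by fun_prop), lintegral_add_right _ measurable_const,
      lintegral_const_mul _ hκm, setLIntegral_const]
  rw [twoStep, ← lintegral_inter_add_sdiff _ A hZ, Set.sdiff_eq, h1, h2, hΛB]
  generalize ν (A ∩ nullPart R) = a₀, ν (B ∩ nullPart R) = b₀, Λ (A ∩ (nullPart R)ᶜ) = a₁,
    Λ (B ∩ (nullPart R)ᶜ) = b₁, ν (nullPart R)ᶜ = e,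
    ∫⁻ x in A ∩ (nullPart R)ᶜ, κ x B ∂Λ = Q
  have hsm : (s + m)⁻¹ * (s + m) = 1 :=
    ENNReal.inv_mul_cancel (by simp [hs0]) (ENNReal.add_ne_top.2 ⟨hs, hm⟩)
  -- The terms in a₁ b₀ collect the coefficient s + m, which cancels the normalization and matches
  -- the term a₀ b₁ coming from a first draw in Z.
  calc a₀ * (s * b₀ + b₁) + (s + m)⁻¹ * ((s * b₀ + b₁) * a₁ + m * (e * Q + b₀ * a₁))
      = s * a₀ * b₀ + a₀ * b₁ + (s + m)⁻¹ * (s + m) * (a₁ * b₀)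
        + (s + m)⁻¹ * (a₁ * b₁ + m * e * Q) := by ring
    _ = _ := by rw [hsm]; ring

lemma twoStep_symm [IsProbabilityMeasure ν] (hθ : 0 < θ) (hR : ∀ x, R x Set.univ ≠ ∞) (hm : m ≠ ∞)
    (hκ : IsInvariantKernel ν κ (nullPart R)ᶜ)
    (hU : ∀ᵐ x ∂ν, x ∈ (nullPart R)ᶜ → IsMixtureAt ν R κ m x)
    (hA : MeasurableSet A) (hB : MeasurableSet B) (hw : ∀ i, IsRegularAt ν R κ m A B (w i)) :
    twoStep θ ν R w A B = twoStep θ ν R w B A := by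
  rw [twoStep_eq hθ hR hm hU hA hB hw, twoStep_eq hθ hR hm hU hB hA fun i => (hw i).symm',
    setLIntegral_urnMeasure_symm hκ hA hB hw]
  ring

end TwoStep

/-! ### From symmetric draws to exchangeability -/

section Exchangeability

lemma past_succ {Ω 𝕏 : Type*} (X : ℕ → Ω → 𝕏) (n : ℕ) (ω : Ω) :
    past X (n + 1) ω = (Fin.snoc (past X n ω) (X n ω) : Fin (n + 1) → 𝕏) := by
  funext i
  refine Fin.lastCases ?_ (fun j => ?_) i
  · simp [past]
  · simp [past]

variable {Ω 𝕏 : Type*} [mΩ : MeasurableSpace Ω] [m𝕏 : MeasurableSpace 𝕏]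

lemma urnMeasure_snoc (θ : ℝ) (ν : Measure 𝕏) (R : Kernel 𝕏 𝕏) {n : ℕ} (w : Fin n → 𝕏) (x : 𝕏) :
    urnMeasure θ ν R (Fin.snoc w x : Fin (n + 1) → 𝕏) = urnMeasure θ ν R w + R x := by
  simp [urnMeasure, Fin.sum_univ_castSucc, add_assoc]

lemma urnMeasure_comp_perm (θ : ℝ) (ν : Measure 𝕏) (R : Kernel 𝕏 𝕏) {n : ℕ} (w : Fin n → 𝕏)
    (σ : Equiv.Perm (Fin n)) : urnMeasure θ ν R (fun i => w (σ i)) = urnMeasure θ ν R w := by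
  simp only [urnMeasure]
  rw [Equiv.sum_comp σ fun i => R (w i)]

lemma measurable_snoc (n : ℕ) :
    Measurable fun q : (Fin n → 𝕏) × 𝕏 => (Fin.snoc q.1 q.2 : Fin (n + 1) → 𝕏) := by
  refine measurable_pi_lambda _ fun i => ?_
  refine Fin.lastCases ?_ (fun j => ?_) i
  · simpa using measurable_snd
  · simp only [Fin.snoc_castSucc]
    exact (measurable_pi_apply j).comp measurable_fst

namespace IsMVPS

variable {P : Measure Ω} {X : ℕ → Ω → 𝕏} {θ : ℝ} {ν : Measure 𝕏}
  {R : Kernel 𝕏 𝕏} [IsProbabilityMeasure P]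

lemma lintegral_pred (hX : IsMVPS P X θ ν R) (n : ℕ) {F : (Fin n → 𝕏) × 𝕏 → ℝ≥0∞}
    (hF : Measurable F) :
    ∫⁻ ω, F (past X n ω, X n ω) ∂P
      = ∫⁻ ω, ∫⁻ y, F (past X n ω, y) ∂urnKernel θ ν R n (past X n ω) ∂P := by
  have := hX.isMarkovKernel n
  have hp := hX.measurable_past n
  rw [← lintegral_map (g := fun ω => (past X n ω, X n ω)) hF (hp.prodMk (hX.measurable n)),
    hX.map_past_prod n, Measure.lintegral_compProd hF, lintegral_map _ hp]
  exact hF.lintegral_kernel_prod_right'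

/-- The law of each observation is absolutely continuous with respect to `ν`. -/
lemma ae_of_ae (hX : IsMVPS P X θ ν R)
    (hR : ∀ {q : 𝕏 → Prop}, (∀ᵐ y ∂ν, q y) → ∀ᵐ x ∂ν, ∀ᵐ y ∂(R x), q y) (n : ℕ) :
    ∀ {q : 𝕏 → Prop}, (∀ᵐ y ∂ν, q y) → ∀ᵐ ω ∂P, q (X n ω) := by
  induction n using Nat.strong_induction_on with
  | _ n ih =>
    intro q hq
    obtain ⟨N, hN, hNm, hN0⟩ := exists_measurable_superset_of_null hq
    have hN' : ∀ᵐ y ∂ν, y ∉ N := measure_eq_zero_iff_ae_notMem.1 hN0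
    have h1 : ∀ᵐ ω ∂P, ∀ i : Fin n, ∀ᵐ y ∂(R (X i ω)), y ∉ N :=
      ae_all_iff.2 fun i => ih i i.2 (hR hN')
    have h2 := hX.lintegral_pred n (F := fun q => N.indicator (fun _ => 1) q.2)
      ((measurable_const.indicator hNm).comp measurable_snd)
    have h3 : ∫⁻ ω, ∫⁻ y, N.indicator (fun _ => 1) y ∂urnKernel θ ν R n (past X n ω) ∂P = 0 := by
      rw [lintegral_congr_ae (g := fun _ => 0), lintegral_zero]
      filter_upwards [h1] with ω hω
      have h0 : urnMeasure θ ν R (past X n ω) N = 0 := by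
        rw [urnMeasure_apply, hN0, mul_zero, zero_add]
        exact Finset.sum_eq_zero fun i _ => measure_eq_zero_iff_ae_notMem.2 (hω i)
      rw [lintegral_indicator_const hNm, urnKernel_apply, Measure.smul_apply, h0, smul_zero,
        mul_zero]
    have hm : Measurable fun ω => N.indicator (fun _ => (1 : ℝ≥0∞)) (X n ω) :=
      (measurable_const.indicator hNm).comp (hX.measurable n)
    rw [h3, lintegral_eq_zero_iff hm] at h2
    filter_upwards [h2] with ω hω
    by_contra hqω
    have : X n ω ∈ N := hN hqω
    simp [this] at hω

/-- Symmetry for each pair A, B, off a null event depending on the pair, suffices because a law on a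
triple product is determined by rectangles. -/
lemma map_swap_last (hX : IsMVPS P X θ ν R) (n : ℕ)
    (hsym : ∀ A B, MeasurableSet A → MeasurableSet B →
      ∀ᵐ ω ∂P, twoStep θ ν R (past X n ω) A B = twoStep θ ν R (past X n ω) B A) :
    P.map (fun ω => (past X n ω, X (n + 1) ω, X n ω))
      = P.map (fun ω => (past X n ω, X n ω, X (n + 1) ω)) := by
  have hp := hX.measurable_past n
  have hx := hX.measurable n
  have hx' := hX.measurable (n + 1)
  have hm1 : Measurable fun ω => (past X n ω, X (n + 1) ω, X n ω) := hp.prodMk (hx'.prodMk hx)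
  have hm2 : Measurable fun ω => (past X n ω, X n ω, X (n + 1) ω) := hp.prodMk (hx.prodMk hx')
  have := Measure.isProbabilityMeasure_map (μ := P) hm1.aemeasurable
  have := Measure.isProbabilityMeasure_map (μ := P) hm2.aemeasurable
  have key : ∀ {W : Set (Fin n → 𝕏)} {A B : Set 𝕏}, MeasurableSet W → MeasurableSet A →
      MeasurableSet B →
      P {ω | past X n ω ∈ W ∧ X n ω ∈ A ∧ X (n + 1) ω ∈ B}
        = ∫⁻ ω, W.indicator (fun _ => 1) (past X n ω) *
          ((urnMeasure θ ν R (past X n ω) Set.univ)⁻¹ * twoStep θ ν R (past X n ω) A B) ∂P := by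
    intro W A B hW hA hB
    have hWi : Measurable (W.indicator fun _ => (1 : ℝ≥0∞)) := measurable_const.indicator hW
    have hAi : Measurable (A.indicator fun _ => (1 : ℝ≥0∞)) := measurable_const.indicator hA
    have hBi : Measurable (B.indicator fun _ => (1 : ℝ≥0∞)) := measurable_const.indicator hB
    have hS : MeasurableSet {ω | past X n ω ∈ W ∧ X n ω ∈ A ∧ X (n + 1) ω ∈ B} :=
      (hp hW).inter ((hx hA).inter (hx' hB))
    have e1 : P {ω | past X n ω ∈ W ∧ X n ω ∈ A ∧ X (n + 1) ω ∈ B}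
        = ∫⁻ ω, W.indicator (fun _ => 1) (past X n ω) * A.indicator (fun _ => 1) (X n ω)
          * B.indicator (fun _ => 1) (X (n + 1) ω) ∂P := by
      rw [← lintegral_indicator_one hS]
      refine lintegral_congr fun ω => ?_
      by_cases h1 : past X n ω ∈ W <;> by_cases h2 : X n ω ∈ A <;>
        by_cases h3 : X (n + 1) ω ∈ B <;> simp [Set.indicator, h1, h2, h3]
    have e2 := hX.lintegral_pred (n + 1)
      (F := fun q => W.indicator (fun _ => 1) (Fin.init q.1) *
        A.indicator (fun _ => 1) (q.1 (Fin.last n)) * B.indicator (fun _ => 1) q.2)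
      (((hWi.comp (measurable_pi_lambda _ fun i => (measurable_pi_apply i.castSucc).comp
        measurable_fst)).mul (hAi.comp ((measurable_pi_apply _).comp measurable_fst))).mul
        (hBi.comp measurable_snd))
    have hF : Measurable fun q : (Fin n → 𝕏) × 𝕏 => W.indicator (fun _ => (1 : ℝ≥0∞)) q.1 *
        (A.indicator (fun _ => 1) q.2 * ((urnMeasure θ ν R q.1 Set.univ + R q.2 Set.univ)⁻¹ *
          (urnMeasure θ ν R q.1 B + R q.2 B))) := by
      have k : ∀ {C}, MeasurableSet C →
          Measurable fun q : (Fin n → 𝕏) × 𝕏 => urnMeasure θ ν R q.1 C + R q.2 C := fun hC =>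
        ((measurable_urnMeasure_apply θ ν R hC).comp measurable_fst).add
          ((R.measurable_coe hC).comp measurable_snd)
      exact (hWi.comp measurable_fst).mul ((hAi.comp measurable_snd).mul
        ((k MeasurableSet.univ).inv.mul (k hB)))
    have e3 := hX.lintegral_pred n hF
    simp only [past_succ, Fin.init_snoc, Fin.snoc_last] at e2
    rw [e1, e2]
    refine Eq.trans (lintegral_congr fun ω => ?_) (e3.trans (lintegral_congr fun ω => ?_))
    · rw [lintegral_const_mul _ hBi, lintegral_indicator_const hB, one_mul, urnKernel_apply,
        urnMeasure_snoc]
      simp only [Measure.smul_apply, Measure.add_apply, smul_eq_mul, mul_assoc]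
    · simp only
      have k1 := R.measurable_coe MeasurableSet.univ
      have k2 := R.measurable_coe hB
      have hF' : Measurable fun x => A.indicator (fun _ => 1) x *
          ((urnMeasure θ ν R (past X n ω) Set.univ + R x Set.univ)⁻¹ *
            (urnMeasure θ ν R (past X n ω) B + R x B)) := by fun_prop
      rw [urnKernel_apply, lintegral_smul_measure, smul_eq_mul, lintegral_const_mul _ hF', twoStep, ← lintegral_indicator hA, mul_left_comm]
      congr 2
      refine lintegral_congr fun x => ?_
      by_cases hx : x ∈ A <;> simp [hx]
  refine Measure.ext_prod₃ fun {W A B} hW hA hB => ?_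
  rw [Measure.map_apply hm1 (hW.prod (hA.prod hB)), Measure.map_apply hm2 (hW.prod (hA.prod hB))]
  have s1 : (fun ω => (past X n ω, X (n + 1) ω, X n ω)) ⁻¹' (W ×ˢ A ×ˢ B)
      = {ω | past X n ω ∈ W ∧ X n ω ∈ B ∧ X (n + 1) ω ∈ A} := by
    ext ω
    simp only [Set.mem_preimage, Set.mem_prod, Set.mem_ofPred_eq]
    tauto
  have s2 : (fun ω => (past X n ω, X n ω, X (n + 1) ω)) ⁻¹' (W ×ˢ A ×ˢ B)
      = {ω | past X n ω ∈ W ∧ X n ω ∈ A ∧ X (n + 1) ω ∈ B} := by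
    ext ω
    simp only [Set.mem_preimage, Set.mem_prod, Set.mem_ofPred_eq]
  rw [s1, s2, key hW hB hA, key hW hA hB]
  refine lintegral_congr_ae ?_
  filter_upwards [hsym A B hA hB] with ω hω
  rw [hω]

/-- The law of the observations does not change under permutations of the past. -/
lemma map_perm_past (hX : IsMVPS P X θ ν R) {n : ℕ} (σ : Equiv.Perm (Fin n))
    (hσ : P.map (fun ω (i : Fin n) => X (σ i) ω) = P.map (fun ω (i : Fin n) => X i ω)) :
    P.map (fun ω => ((fun i : Fin n => X (σ i) ω), X n ω))
      = P.map (fun ω => (past X n ω, X n ω)) := by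
  have hp := hX.measurable_past n
  have hx := hX.measurable n
  have hpσ : Measurable fun ω (i : Fin n) => X (σ i) ω := measurable_pi_lambda _ fun i =>
    hX.measurable _
  have hm1 := hpσ.prodMk hx
  have hm2 := hp.prodMk hx
  have := Measure.isProbabilityMeasure_map (μ := P) hm1.aemeasurable
  have := Measure.isProbabilityMeasure_map (μ := P) hm2.aemeasurable
  refine Measure.ext_prod fun {W B} hW hB => ?_
  rw [Measure.map_apply hm1 (hW.prod hB), Measure.map_apply hm2 (hW.prod hB)]
  have hWi : Measurable (W.indicator fun _ => (1 : ℝ≥0∞)) := measurable_const.indicator hW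
  have hBi : Measurable (B.indicator fun _ => (1 : ℝ≥0∞)) := measurable_const.indicator hB
  have key : ∀ (φ : (Fin n → 𝕏) → Fin n → 𝕏), Measurable φ →
      P ((fun ω => (φ (past X n ω), X n ω)) ⁻¹' W ×ˢ B)
      = ∫⁻ ω, W.indicator (fun _ => 1) (φ (past X n ω)) *
        urnKernel θ ν R n (past X n ω) B ∂P := fun φ hφ => by
    have h := hX.lintegral_pred n (F := fun q => W.indicator (fun _ => 1) (φ q.1) *
      B.indicator (fun _ => 1) q.2) ((hWi.comp (hφ.comp measurable_fst)).mul
        (hBi.comp measurable_snd))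
    have hS : MeasurableSet ((fun ω => (φ (past X n ω), X n ω)) ⁻¹' W ×ˢ B) :=
      ((hφ.comp hp).prodMk hx) (hW.prod hB)
    rw [← lintegral_indicator_one hS]
    refine (lintegral_congr fun ω => ?_).trans (h.trans (lintegral_congr fun ω => ?_))
    · by_cases h1 : φ (past X n ω) ∈ W <;> by_cases h2 : X n ω ∈ B <;>
        simp [Set.indicator, h1, h2]
    · simp only
      rw [lintegral_const_mul _ hBi, lintegral_indicator_const hB, one_mul]
  have k1 := key (fun w i => w (σ i)) (by fun_prop)
  have k2 := key id measurable_id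
  refine k1.trans (Eq.trans ?_ k2.symm)
  -- The urn depends on the past through a sum, so reordering the past leaves the predictive law
  -- unchanged.
  have e : ∀ w : Fin n → 𝕏, urnKernel θ ν R n (fun i => w (σ i)) = urnKernel θ ν R n w :=
    fun w => by rw [urnKernel_apply, urnKernel_apply, urnMeasure_comp_perm]
  have hH : Measurable fun w : Fin n → 𝕏 => W.indicator (fun _ => 1) w *
      urnKernel θ ν R n w B := hWi.mul ((urnKernel θ ν R n).measurable_coe hB)
  have l1 := lintegral_map (μ := P) hH hpσ
  have l2 := lintegral_map (μ := P) hH hp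
  rw [hσ] at l1
  have l3 := l1.symm.trans l2
  refine Eq.trans (lintegral_congr fun ω => ?_) l3
  rw [← e (past X n ω)]
  rfl

/-- Adjacent transpositions generate the symmetric group. The one that moves the last observation is
the two-step symmetry; the others only permute the past and follow by induction from
`map_perm_past`. -/
theorem isExchangeable_of_twoStep_symm (hX : IsMVPS P X θ ν R)
    (hsym : ∀ n A B, MeasurableSet A → MeasurableSet B →
      ∀ᵐ ω ∂P, twoStep θ ν R (past X n ω) A B = twoStep θ ν R (past X n ω) B A) :
    IsExchangeable P X := by
  intro n
  induction n with
  | zero =>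
    intro σ
    rw [Subsingleton.elim σ 1]
    rfl
  | succ n ih =>
    have hmul : ∀ σ τ : Equiv.Perm (Fin (n + 1)),
        P.map (fun ω (i : Fin (n + 1)) => X (σ i) ω) = P.map (fun ω (i : Fin (n + 1)) => X i ω) →
        P.map (fun ω (i : Fin (n + 1)) => X (τ i) ω) = P.map (fun ω (i : Fin (n + 1)) => X i ω) →
        P.map (fun ω (i : Fin (n + 1)) => X ((σ * τ) i) ω)
          = P.map (fun ω (i : Fin (n + 1)) => X i ω) := fun σ τ hσ hτ => by
      have hφ : Measurable fun (w : Fin (n + 1) → 𝕏) (i : Fin (n + 1)) => w (τ i) := by fun_prop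
      have m1 : Measurable fun ω (i : Fin (n + 1)) => X (σ i) ω :=
        measurable_pi_lambda _ fun i => hX.measurable _
      have m2 : Measurable fun ω (i : Fin (n + 1)) => X i ω :=
        measurable_pi_lambda _ fun i => hX.measurable _
      have k1 := Measure.map_map (μ := P) hφ m1
      have k2 := Measure.map_map (μ := P) hφ m2
      rw [hσ, k2] at k1
      exact k1.symm.trans hτ
    intro σ
    have hmem : σ ∈ Submonoid.closure
        (Set.range fun i : Fin n => Equiv.swap i.castSucc i.succ) := by
      rw [Equiv.Perm.mclosure_swap_castSucc_succ]
      trivial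
    induction hmem using Submonoid.closure_induction with
    | one => rfl
    | mul σ τ _ _ hσ hτ => exact hmul σ τ hσ hτ
    | mem σ hσ =>
      obtain ⟨i, rfl⟩ := hσ
      cases n with
      | zero => exact i.elim0
      | succ n =>
        simp only
        refine Fin.lastCases ?_ (fun j => ?_) i
        · have hsnoc : Measurable fun q : (Fin n → 𝕏) × 𝕏 × 𝕏 =>
              (Fin.snoc (Fin.snoc q.1 q.2.1 : Fin (n + 1) → 𝕏) q.2.2 : Fin (n + 2) → 𝕏) :=
            (measurable_snoc (n + 1)).comp (((measurable_snoc n).comp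
              (measurable_fst.prodMk (measurable_fst.comp measurable_snd))).prodMk
              (measurable_snd.comp measurable_snd))
          have h := congrArg (Measure.map fun q : (Fin n → 𝕏) × 𝕏 × 𝕏 =>
              (Fin.snoc (Fin.snoc q.1 q.2.1 : Fin (n + 1) → 𝕏) q.2.2 : Fin (n + 2) → 𝕏))
              (hX.map_swap_last n (hsym n))
          have hp := hX.measurable_past n
          rw [Measure.map_map hsnoc (hp.prodMk ((hX.measurable _).prodMk (hX.measurable _))),
            Measure.map_map hsnoc (hp.prodMk ((hX.measurable _).prodMk (hX.measurable _)))] at h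
          convert h using 2
          · funext ω k
            refine Fin.lastCases ?_ (fun k => Fin.lastCases ?_ (fun k => ?_) k) k
            · simp
            · simp
            · rw [Equiv.swap_apply_of_ne_of_ne]
              · simp [past]
              · simp [Fin.ext_iff, k.2.ne]
              · simp [Fin.ext_iff, (k.2.trans (Nat.lt_succ_self n)).ne]
          · funext ω k
            refine Fin.lastCases ?_ (fun k => Fin.lastCases ?_ (fun k => ?_) k) k
            · simp
            · simp
            · simp [past]
        · have h := congrArg (Measure.map fun q : (Fin (n + 1) → 𝕏) × 𝕏 =>
              (Fin.snoc q.1 q.2 : Fin (n + 2) → 𝕏))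
              (hX.map_perm_past (Equiv.swap j.castSucc j.succ) (ih _))
          rw [Measure.map_map (measurable_snoc _) ((measurable_pi_lambda _ fun i =>
              hX.measurable _).prodMk (hX.measurable _)),
            Measure.map_map (measurable_snoc _)
              ((hX.measurable_past _).prodMk (hX.measurable _))] at h
          convert h using 2
          · funext ω k
            refine Fin.lastCases ?_ (fun k => ?_) k
            · rw [Equiv.swap_apply_of_ne_of_ne]
              · simp
              · simp [Fin.ext_iff, (j.2.trans (Nat.lt_succ_self n)).ne']
              · simp [Fin.ext_iff, j.2.ne']
            · rw [← Fin.castSucc_succ, (Fin.castSucc_injective (n + 1)).swap_apply]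
              simp
          · funext ω k
            refine Fin.lastCases ?_ (fun k => ?_) k
            · simp
            · simp [past]

end IsMVPS

end Exchangeability

/-! ### From the mixture form to exchangeability -/

section Converse

lemma HasMixtureForm.ae_isMixtureAt {𝕏 : Type*} {G : MeasurableSpace 𝕏} {m𝕏 : MeasurableSpace 𝕏}
    [StandardBorelSpace 𝕏] {ν : Measure 𝕏} [IsFiniteMeasure ν] {R κ : Kernel 𝕏 𝕏}
    (h : HasMixtureForm G ν R) (hR : ∀ x, R x Set.univ ≠ ∞) {m : ℝ}
    (hm : ∀ᵐ x ∂ν, x ∈ (nullPart R)ᶜ → (R x).real Set.univ = m)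
    (hκ : ∀ x, κ x = condExpKernel ν G x) :
    ∀ᵐ x ∂ν, x ∈ (nullPart R)ᶜ → IsMixtureAt ν R κ (ENNReal.ofReal m) x := by
  filter_upwards [h, hm] with x hx hmx hxZ
  have hmass : R x Set.univ = ENNReal.ofReal m := by
    rw [← hmx hxZ, Measure.real, ENNReal.ofReal_toReal (hR x)]
  have hZ : ν (nullPart R) • ν[|nullPart R] = ν.restrict (nullPart R) := by
    rw [ProbabilityTheory.cond, smul_smul]
    -- If ν(Z) = 0 both sides are the zero measure, in accordance with reading the last term of the
    -- mixture as 0.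
    by_cases h0 : ν (nullPart R) = 0
    · rw [h0, zero_mul, zero_smul, Measure.restrict_eq_zero.2 h0]
    · rw [ENNReal.mul_inv_cancel h0 (measure_ne_top ν _), one_smul]
  refine ⟨hmass, ?_⟩
  rw [hκ, ← hZ, ← hx hxZ, ← hmass, smul_smul, ENNReal.mul_inv_cancel hxZ (hR x), one_smul]

lemma HasMixtureForm.exists_isInvariantKernel {𝕏 : Type*} {G : MeasurableSpace 𝕏}
    {m𝕏 : MeasurableSpace 𝕏} [StandardBorelSpace 𝕏] {ν : Measure 𝕏} [IsFiniteMeasure ν]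
    {R : Kernel 𝕏 𝕏} (h : HasMixtureForm G ν R) (hG : G ≤ m𝕏)
    (hZ : MeasurableSet[G] (nullPart R)ᶜ) (hR : ∀ x, R x Set.univ ≠ ∞) {m : ℝ}
    (hm : ∀ᵐ x ∂ν, x ∈ (nullPart R)ᶜ → (R x).real Set.univ = m) :
    ∃ κ : Kernel 𝕏 𝕏, IsInvariantKernel ν κ (nullPart R)ᶜ ∧
      ∀ᵐ x ∂ν, x ∈ (nullPart R)ᶜ → IsMixtureAt ν R κ (ENNReal.ofReal m) x :=
  ⟨(condExpKernel ν G).comap id (measurable_id'' hG),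
    isInvariantKernel_condExpKernel hG hZ fun _ => rfl, h.ae_isMixtureAt hR hm fun _ => rfl⟩

theorem IsMVPS.isExchangeable_of_hasMixtureForm {Ω 𝕏 : Type*} [MeasurableSpace Ω]
    [m𝕏 : MeasurableSpace 𝕏] [StandardBorelSpace 𝕏] {P : Measure Ω}
    [IsProbabilityMeasure P] {X : ℕ → Ω → 𝕏} {θ : ℝ} {ν : Measure 𝕏} [IsProbabilityMeasure ν]
    {R : Kernel 𝕏 𝕏} (hX : IsMVPS P X θ ν R) (hb : BalancedOffNull ν R)
    (h : ∃ G : MeasurableSpace 𝕏, G ≤ m𝕏 ∧ MeasurableSet[G] (nullPart R)ᶜ ∧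
      HasMixtureForm G ν R) : IsExchangeable P X := by
  obtain ⟨m, -, hm⟩ := hb
  have hR : ∀ x, R x Set.univ ≠ ∞ := fun x => (hX.finite_kernel x).ne
  obtain ⟨κ, hinv, hU⟩ : ∃ κ : Kernel 𝕏 𝕏, IsInvariantKernel ν κ (nullPart R)ᶜ ∧
      ∀ᵐ x ∂ν, x ∈ (nullPart R)ᶜ → IsMixtureAt ν R κ (ENNReal.ofReal m) x :=
    Exists.elim h fun _ hG => hG.2.2.exists_isInvariantKernel hG.1 hG.2.1 hR hm
  refine hX.isExchangeable_of_twoStep_symm fun n A B hA hB => ?_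
  -- The reinforcement charges no ν-null set, so each observation has a law absolutely continuous
  -- with respect to ν, and a.e. regularity holds along the whole past almost surely.
  have hreg : ∀ᵐ ω ∂P, ∀ i : Fin n, IsRegularAt ν R κ (ENNReal.ofReal m) A B (past X n ω i) :=
    ae_all_iff.2 fun i => hX.ae_of_ae (ae_ae_of_isMixtureAt hinv hU) i
      (ae_isRegularAt hinv hU hA hB)
  filter_upwards [hreg] with ω hω
  exact twoStep_symm hX.theta_pos hR ENNReal.ofReal_ne_top hinv hU hA hB hω

end Converse

theorem mainTheorem2 {Ω 𝕏 : Type*} [MeasurableSpace Ω] [m𝕏 : MeasurableSpace 𝕏]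
    [StandardBorelSpace 𝕏] (P : Measure Ω) [IsProbabilityMeasure P] (X : ℕ → Ω → 𝕏)
    (θ : ℝ) (ν : Measure 𝕏) [IsProbabilityMeasure ν] (R : Kernel 𝕏 𝕏)
    (hX : IsMVPS P X θ ν R) :
    (IsExchangeable P X → 0 < ν (nullPart R) → ν (nullPart R) < 1 →
      ∃ G : MeasurableSpace 𝕏, G ≤ m𝕏 ∧ CGUnder G ν ∧ MeasurableSet[G] (nullPart R)ᶜ ∧
        HasMixtureForm G ν R) ∧
    (BalancedOffNull ν R →
      (∃ G : MeasurableSpace 𝕏, G ≤ m𝕏 ∧ MeasurableSet[G] (nullPart R)ᶜ ∧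
        HasMixtureForm G ν R) →
      IsExchangeable P X) :=
  ⟨hX.exists_hasMixtureForm, hX.isExchangeable_of_hasMixtureForm⟩
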